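/- **Setting.** Let $(M,g)$ be a smooth Lorentzian manifold of dimension $n+2$, signature $(-,+,\dots,+)$, and let $\gamma:I\to M$ ($I$ an open interval) be an affinely parametrized null geodesic, $k=\dot\gamma$, representing the unparametrized null geodesic $[\gamma]\in\mathcal N$. Let $\mathcal J$ be the space of Jacobi fields $J$ along $\gamma$ with $g(\nabla_kJ,k)=0$. Then $T_{[\gamma]}\mathcal N=\mathcal J/\langle k,tk\rangle$, the contact hyperplane is $\{g(k,\cdot)=0\}$, and the symplectization $S\to\mathcal N$ (the bundle of positive contact covectors) has tangent space $\mathcal J/\langle k\rangle$ over $[\gamma]$. A contact-scale $1$-jet $\eta=j^1_{[\gamma]}\theta\in J^1S_{[\gamma]}$ consists of the value of a section at $[\gamma]$, a covector $\theta=a\,g(k,\cdot)$ with $a>0$, and its differential, a linear section $\sigma$ of $\mathcal J/\langle k\rangle\to\mathcal J/\langle k,tk\rangle$. With $\omega(X,Y)=g(\nabla_kX,Y)-g(X,\nabla_kY)$, its Reeb direction $R_\eta\in T_{[\gamma]}\mathcal N$ is determined by $\theta(R_\eta)=1$ and $\omega(\sigma R_\eta,\sigma\,\cdot)=0$. An *$\eta$-adapted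 chart* $\Phi:(u,x,v)\mapsto M$, $x\in\mathbb R^n$, is a diffeomorphism from an open subset of $\mathbb R\times\mathbb R^n\times\mathbb R$ containing $\{(u,0,0):u\in J\}$, $J=J_\Phi$ a non-empty open interval, onto an open subset of $M$, such that $\Phi(u,0,0)=\gamma(a(u+c))$ on $J$ for some constant $c=c_\Phi$; such that $$\Phi^*g=2\,du\,dv+A\,dv^2+2B_i\,dv\,dx^i+C_{ij}\,dx^i\,dx^j ;$$ and such that $\Phi_*\partial_v$ along the axis is a Jacobi field representing $R_\eta$. Put $\delta_\varepsilon(u,x,v)=(u,\varepsilon x,\varepsilon^2v)$ and give $u,x,v$ (and $du,dx,dv$) the weights $0,1,2$. A field has weighted order $\ge r$ if its Taylor expansion along the axis has no term of weight $<r$. A plane-wave metric on $J\times\mathbb R^n\times\mathbb R$ is a metric $2\,du\,dv+C_{ij}(u)\,dx^i\,dx^j$ with $C$ smooth and positive definite; a plane-wave germ $(P,g^P,\Gamma)$ is a Lorentzian manifold $P$ with an affinely parametrized null geodesic $\Gamma$ which near each point of $\Gamma$ has such coordinates, with $\Gamma=\{x=v=0\}$ (only the germ along $\Gamma$ matters).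 For $\eta$-adapted charts $\Phi,\widetilde\Phi$ put $\psi=\widetilde\Phi^{-1}\circ\Phi$ and $J_{\Phi\widetilde\Phi}=\{u\in J_\Phi: u+c_\Phi-c_{\widetilde\Phi}\in J_{\widetilde\Phi}\}$. The charts are *compatibly normalized along $\gamma$* if $c_\Phi=c_{\widetilde\Phi}$ and, for $u\in J_{\Phi\widetilde\Phi}$, $\Phi_*\partial_{x^i}\equiv\widetilde\Phi_*\partial_{x^i}$ modulo $k$ at $(u,0,0)$. **Theorem.** Let $\gamma$ and $\eta$ be as above. 1. There is a plane-wave germ $(PW_{[\gamma],\eta},g^{PW}_{[\gamma],\eta},\Gamma)$, with $\Gamma$ defined on $\bigcup_\Phi(J_\Phi+c_\Phi)$ (the part of $\gamma$ covered by $\eta$-adapted charts), and for every $\eta$-adapted chart $\Phi$ a coordinate system $\iota_\Phi$ on $PW_{[\gamma],\eta}$ with domain $J_\Phi\times\mathbb R^n\times\mathbb R$ and $\iota_\Phi(u,0,0)=\Gamma(u+c_\Phi)$, in which $g^{PW}_\Phi:=\iota_\Phi^*g^{PW}_{[\gamma],\eta}$ is a plane-wave metric, such that $$\varepsilon^{-2}\delta_\varepsilon^*(\Phi^*g)\longrightarrow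 g^{PW}_\Phi\qquad(\varepsilon\to0^+)$$ with all derivatives, uniformly on compact subsets of $J_\Phi\times\mathbb R^n\times\mathbb R$; such that $\Phi^*g=g^{PW}_\Phi+h$ with $h$ of weighted order $\ge3$ along the axis; and such that $\iota_\Phi(p)=\iota_{\widetilde\Phi}(\tilde p)$ exactly when $u(p)+c_\Phi=u(\tilde p)+c_{\widetilde\Phi}$ and $\tilde p=\psi_0(p)$, with $\psi_0$ as in 4. 2. It is unique up to canonical isometry: for two such germs with coordinates $\iota_\Phi$, $\iota'_\Phi$ there is exactly one isometry between the unions of the coordinate domains with $F\circ\iota_\Phi=\iota'_\Phi$ for all $\Phi$; it maps $\Gamma$ to $\Gamma'$. 3. For every $\eta$-adapted chart $\Phi$ and every plane-wave metric $q$ on $J_\Phi\times\mathbb R^n\times\mathbb R$, the convergence $\varepsilon^{-2}\delta_\varepsilon^*(\Phi^*g)\to q$ smoothly on compact sets is equivalent to $\Phi^*g-q$ being of weighted order $\ge3$. 4. For all $\eta$-adapted charts $\Phi,\widetilde\Phi$, the transition map $\psi$ preserves the axis: $\psi(u,0,0)=(u+c_\Phi-c_{\widetilde\Phi},0,0)$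 for $u\in J_{\Phi\widetilde\Phi}$. The limit $\psi_0=\lim_{\varepsilon\to0^+}\delta_\varepsilon^{-1}\circ\psi\circ\delta_\varepsilon$ exists smoothly on compact subsets of $J_{\Phi\widetilde\Phi}\times\mathbb R^n\times\mathbb R$; it is a smooth bijection onto $J_{\widetilde\Phi\Phi}\times\mathbb R^n\times\mathbb R$, commutes with the dilations $\delta_\lambda$, $\lambda>0$, and carries one limit isometrically onto the other, $\psi_0^*\,g^{PW}_{\widetilde\Phi}=g^{PW}_\Phi$. 5. If moreover $\Phi,\widetilde\Phi$ are compatibly normalized along $\gamma$, then $\psi_0=\mathrm{id}$, and $\psi$ is the identity modulo strictly higher weighted order: the $u$-, $x$- and $v$-components of $\psi-\mathrm{id}$ have weighted order $\ge1$, $\ge2$ and $\ge3$ along the axis. -/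

import Mathlib

open Set Filter
open scoped Manifold ContDiff Topology

set_option linter.unusedSectionVars false

universe u

noncomputable section

/-! ### Lorentzian metrics, covariant derivatives along curves, null geodesics -/

section Lorentz

variable {E : Type*} [NormedAddCommGroup E] [NormedSpace ℝ E]
  {M : Type*} [TopologicalSpace M] [ChartedSpace E M] [IsManifold 𝓘(ℝ, E) ∞ M]

variable (E M) in
/-- A smooth Lorentzian metric, of signature `(-, +, …, +)`, on a manifold modelled on `E`. -/
structure LorentzMetric where
  toFun : ∀ x : M, TangentSpace 𝓘(ℝ, E) x →L[ℝ] TangentSpace 𝓘(ℝ, E) x →L[ℝ] ℝ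
  symm : ∀ (x : M) (v w : TangentSpace 𝓘(ℝ, E) x), toFun x v w = toFun x w v
  signature : ∀ x : M, ∃ t : TangentSpace 𝓘(ℝ, E) x, toFun x t t < 0 ∧
    ∀ w : TangentSpace 𝓘(ℝ, E) x, toFun x t w = 0 → w ≠ 0 → 0 < toFun x w w
  smooth : ContMDiff 𝓘(ℝ, E) (𝓘(ℝ, E).prod 𝓘(ℝ, E →L[ℝ] E →L[ℝ] ℝ)) ∞
    (fun x => Bundle.TotalSpace.mk' (E →L[ℝ] E →L[ℝ] ℝ) x (toFun x))

/-- The bilinear form at `x`, on the model space `E` to which every tangent space is equal. -/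
def LorentzMetric.form (g : LorentzMetric E M) (x : M) : E →L[ℝ] E →L[ℝ] ℝ := g.toFun x

/-- The differential of a map from a normed space to a manifold. -/
def tangentMapAt {F : Type*} [NormedAddCommGroup F] [NormedSpace ℝ F]
    (f : F → M) (p : F) : F →L[ℝ] E := mfderiv 𝓘(ℝ, F) 𝓘(ℝ, E) f p

/-- The pullback `f^* g` of a Lorentzian metric by a map defined on a normed space. -/
def LorentzMetric.pullback {F : Type*} [NormedAddCommGroup F] [NormedSpace ℝ F]
    (g : LorentzMetric E M) (f : F → M) (p : F) : F →L[ℝ] F →L[ℝ] ℝ :=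
  (g.form (f p)).bilinearComp (tangentMapAt f p) (tangentMapAt f p)

/-- The metric coefficients in the preferred chart at `x₀`, as a function on the model space. -/
def LorentzMetric.coeff (g : LorentzMetric E M) (x₀ : M) (y : E) : E →L[ℝ] E →L[ℝ] ℝ :=
  g.pullback (extChartAt 𝓘(ℝ, E) x₀).symm y

set_option maxSynthPendingDepth 3 in
/-- The Christoffel symbols of the first kind in the chart at `x₀`:
`½ (∂_a g(b,w) + ∂_b g(a,w) - ∂_w g(a,b))`, as a trilinear form in `a, b, w`. -/
def LorentzMetric.christoffelFirst (g : LorentzMetric E M) (x₀ : M) (y : E) :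
    E →L[ℝ] E →L[ℝ] E →L[ℝ] ℝ :=
  let D : E →L[ℝ] E →L[ℝ] E →L[ℝ] ℝ := fderiv ℝ (g.coeff x₀) y
  (1 / 2 : ℝ) • (D + D.flip -
    ((ContinuousLinearMap.flipₗᵢ ℝ E E ℝ).toContinuousLinearEquiv :
      (E →L[ℝ] E →L[ℝ] ℝ) →L[ℝ] (E →L[ℝ] E →L[ℝ] ℝ)) ∘L D.flip)

/-- The Christoffel symbols (of the second kind) of the Levi-Civita connection in the chart
at `x₀`. -/
def LorentzMetric.christoffel (g : LorentzMetric E M) (x₀ : M) (y : E) : E →L[ℝ] E →L[ℝ] E :=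
  (ContinuousLinearMap.compL ℝ E (E →L[ℝ] ℝ) E (g.coeff x₀ y).inverse) ∘L
    g.christoffelFirst x₀ y

/-- The curvature `R(X,Y)Z = ∇_X ∇_Y Z - ∇_Y ∇_X Z - ∇_[X,Y] Z` in the chart at `x₀`. -/
def LorentzMetric.curvature (g : LorentzMetric E M) (x₀ : M) (y : E) (X Y Z : E) : E :=
  fderiv ℝ (g.christoffel x₀) y X Y Z - fderiv ℝ (g.christoffel x₀) y Y X Z
    + g.christoffel x₀ y X (g.christoffel x₀ y Y Z)
    - g.christoffel x₀ y Y (g.christoffel x₀ y X Z)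

/-- The velocity of a curve. -/
def velocity (γ : ℝ → M) (t : ℝ) : TangentSpace 𝓘(ℝ, E) (γ t) :=
  mfderiv 𝓘(ℝ, ℝ) 𝓘(ℝ, E) γ t (1 : ℝ)

/-- A vector field along `γ`, read near `t₀` in the chart at `γ t₀`. -/
def coordRep (γ : ℝ → M) (V : ∀ t : ℝ, TangentSpace 𝓘(ℝ, E) (γ t)) (t₀ s : ℝ) : E :=
  mfderiv 𝓘(ℝ, E) 𝓘(ℝ, E) (extChartAt 𝓘(ℝ, E) (γ t₀)) (γ s) (V s)

/-- The Christoffel correction `Γ(γ', V)` at `t`, in the chart at `γ t`. -/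
def connectionTerm (g : LorentzMetric E M) (γ : ℝ → M)
    (V : ∀ t : ℝ, TangentSpace 𝓘(ℝ, E) (γ t)) (t : ℝ) : E :=
  g.christoffel (γ t) (extChartAt 𝓘(ℝ, E) (γ t) (γ t))
    (coordRep γ (velocity γ) t t) (coordRep γ V t t)

/-- The vector field `V` along `γ` has covariant derivative `w` at `t`, where `w` is written in
the chart at `γ t`. -/
def HasCovDerivAt (g : LorentzMetric E M) (γ : ℝ → M)
    (V : ∀ t : ℝ, TangentSpace 𝓘(ℝ, E) (γ t)) (w : E) (t : ℝ) : Prop :=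
  HasDerivAt (coordRep γ V t) (w - connectionTerm g γ V t) t

/-- The covariant derivative of `V` along `γ` at `t`, written in the chart at `γ t`. -/
def covDerivCoord (g : LorentzMetric E M) (γ : ℝ → M)
    (V : ∀ t : ℝ, TangentSpace 𝓘(ℝ, E) (γ t)) (t : ℝ) : E :=
  deriv (coordRep γ V t) t + connectionTerm g γ V t

/-- `γ` is an affinely parametrized null geodesic on the open set `S` of parameters. -/
structure IsNullGeodesicOn (g : LorentzMetric E M) (γ : ℝ → M) (S : Set ℝ) : Prop where
  isOpen : IsOpen S
  smooth : ContMDiffOn 𝓘(ℝ, ℝ) 𝓘(ℝ, E) ∞ γ S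
  velocity_ne_zero : ∀ t ∈ S, (velocity γ t : TangentSpace 𝓘(ℝ, E) (γ t)) ≠ 0
  null : ∀ t ∈ S, g.toFun (γ t) (velocity γ t) (velocity γ t) = 0
  geodesic : ∀ t ∈ S, HasCovDerivAt g γ (velocity γ) 0 t

end Lorentz

/-! ### Tangent spaces of the space of null geodesics, contact scales and their 1-jets -/

section Contact

variable {E : Type*} [NormedAddCommGroup E] [NormedSpace ℝ E]
  {M : Type*} [TopologicalSpace M] [ChartedSpace E M] [IsManifold 𝓘(ℝ, E) ∞ M]

/-- `V` is a Jacobi field along `γ` over `I`, `∇_k ∇_k V + R(V,k)k = 0` with `k = γ'`, which is an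
infinitesimal variation through null geodesics, `g(∇_k V, k) = 0`. Fields along `γ` are extended by
`0` outside `I`. -/
def IsNullJacobi (g : LorentzMetric E M) (γ : ℝ → M) (I : Set ℝ)
    (V : ∀ t : ℝ, TangentSpace 𝓘(ℝ, E) (γ t)) : Prop :=
  (∀ t, t ∉ I → V t = 0) ∧
  ∃ W : ∀ t : ℝ, TangentSpace 𝓘(ℝ, E) (γ t), ∀ t ∈ I,
    HasCovDerivAt g γ V (coordRep γ W t t) t ∧
    HasCovDerivAt g γ W
      (-g.curvature (γ t) (extChartAt 𝓘(ℝ, E) (γ t) (γ t)) (coordRep γ V t t)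
        (coordRep γ (velocity γ) t t) (coordRep γ (velocity γ) t t)) t ∧
    g.toFun (γ t) (W t) (velocity γ t) = 0

theorem coordRep_add (γ : ℝ → M) (V W : ∀ t : ℝ, TangentSpace 𝓘(ℝ, E) (γ t)) (t₀ : ℝ) :
    coordRep γ (V + W) t₀ = coordRep γ V t₀ + coordRep γ W t₀ := by
  funext s
  simp only [coordRep, Pi.add_apply]
  exact map_add _ _ _

theorem coordRep_smul (γ : ℝ → M) (c : ℝ) (V : ∀ t : ℝ, TangentSpace 𝓘(ℝ, E) (γ t)) (t₀ : ℝ) :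
    coordRep γ (c • V) t₀ = c • coordRep γ V t₀ := by
  funext s
  simp only [coordRep, Pi.smul_apply]
  exact map_smul _ _ _

theorem HasCovDerivAt.add {g : LorentzMetric E M} {γ : ℝ → M}
    {V W : ∀ t : ℝ, TangentSpace 𝓘(ℝ, E) (γ t)} {v w : E} {t : ℝ}
    (hV : HasCovDerivAt g γ V v t) (hW : HasCovDerivAt g γ W w t) :
    HasCovDerivAt g γ (V + W) (v + w) t := by
  unfold HasCovDerivAt at *
  rw [coordRep_add]
  convert HasDerivAt.add hV hW using 1
  simp only [connectionTerm, coordRep_add, Pi.add_apply, map_add]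
  abel

theorem HasCovDerivAt.smul {g : LorentzMetric E M} {γ : ℝ → M}
    {V : ∀ t : ℝ, TangentSpace 𝓘(ℝ, E) (γ t)} {v : E} {t : ℝ} (c : ℝ)
    (hV : HasCovDerivAt g γ V v t) :
    HasCovDerivAt g γ (c • V) (c • v) t := by
  unfold HasCovDerivAt at *
  rw [coordRep_smul]
  convert HasDerivAt.const_smul c hV using 1
  simp only [connectionTerm, coordRep_smul, Pi.smul_apply, map_smul, smul_sub]

theorem curvature_add (g : LorentzMetric E M) (x₀ : M) (y X X' Y Z : E) :
    g.curvature x₀ y (X + X') Y Z = g.curvature x₀ y X Y Z + g.curvature x₀ y X' Y Z := by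
  simp only [LorentzMetric.curvature, map_add, add_apply]
  abel

theorem curvature_smul (g : LorentzMetric E M) (x₀ : M) (c : ℝ) (y X Y Z : E) :
    g.curvature x₀ y (c • X) Y Z = c • g.curvature x₀ y X Y Z := by
  simp only [LorentzMetric.curvature, map_smul, smul_apply, smul_sub, smul_add]

/-- The space `𝒥` of Jacobi fields along `γ` which are variations through null geodesics. -/
def nullJacobi (g : LorentzMetric E M) (γ : ℝ → M) (I : Set ℝ) :
    Submodule ℝ (∀ t : ℝ, TangentSpace 𝓘(ℝ, E) (γ t)) where
  carrier := {V | IsNullJacobi g γ I V}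
  zero_mem' := by
    have h0 : ∀ t₀ : ℝ, coordRep γ (0 : ∀ t : ℝ, TangentSpace 𝓘(ℝ, E) (γ t)) t₀ = 0 := by
      intro t₀
      have := coordRep_smul γ 0 (0 : ∀ t : ℝ, TangentSpace 𝓘(ℝ, E) (γ t)) t₀
      simpa using this
    have hc : ∀ t, HasCovDerivAt g γ 0 0 t := by
      intro t
      unfold HasCovDerivAt
      simp only [connectionTerm, h0, Pi.zero_apply, map_zero, sub_zero]
      exact hasDerivAt_const t (0 : E)
    refine ⟨fun t _ => rfl, 0, fun t _ => ⟨?_, ?_, ?_⟩⟩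
    · simpa [h0] using hc t
    · simpa [h0, LorentzMetric.curvature] using hc t
    · simp
  add_mem' := by
    rintro V V' ⟨hV, W, hW⟩ ⟨hV', W', hW'⟩
    refine ⟨fun t ht => by simp [hV t ht, hV' t ht], W + W', fun t ht => ⟨?_, ?_, ?_⟩⟩
    · rw [coordRep_add]
      exact (hW t ht).1.add (hW' t ht).1
    · rw [coordRep_add, Pi.add_apply, curvature_add, neg_add]
      exact (hW t ht).2.1.add (hW' t ht).2.1
    · simp [(hW t ht).2.2, (hW' t ht).2.2]
  smul_mem' := by
    rintro c V ⟨hV, W, hW⟩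
    refine ⟨fun t ht => by simp [hV t ht], c • W, fun t ht => ⟨?_, ?_, ?_⟩⟩
    · rw [coordRep_smul]
      exact (hW t ht).1.smul c
    · rw [coordRep_smul, Pi.smul_apply, curvature_smul, ← smul_neg]
      exact (hW t ht).2.1.smul c
    · simp [(hW t ht).2.2]

/-- The field `k = γ'`, extended by `0` outside `I`. -/
def tangentField (γ : ℝ → M) (I : Set ℝ) (t : ℝ) : TangentSpace 𝓘(ℝ, E) (γ t) :=
  open scoped Classical in if t ∈ I then velocity γ t else 0

/-- The subspace `⟨k⟩` of `𝒥`. -/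
def spanK (g : LorentzMetric E M) (γ : ℝ → M) (I : Set ℝ) : Submodule ℝ (nullJacobi g γ I) :=
  (Submodule.span ℝ {tangentField γ I}).comap (nullJacobi g γ I).subtype

/-- The subspace `⟨k, t k⟩` of `𝒥`, where `t` is the affine parameter. -/
def spanKTK (g : LorentzMetric E M) (γ : ℝ → M) (I : Set ℝ) : Submodule ℝ (nullJacobi g γ I) :=
  (Submodule.span ℝ {tangentField γ I, fun t => t • tangentField γ I t}).comap
    (nullJacobi g γ I).subtype

/-- The tangent space `𝒥 / ⟨k, t k⟩` at `[γ]` of the manifold `𝒩` of unparametrized null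
geodesics. -/
abbrev NullGeodesicTangent (g : LorentzMetric E M) (γ : ℝ → M) (I : Set ℝ) :=
  nullJacobi g γ I ⧸ spanKTK g γ I

/-- The tangent space `𝒥 / ⟨k⟩` of the symplectization `S` of `𝒩`, at a point over `[γ]`: `S` is
the space of affinely parametrized null geodesics up to translation of the parameter. The vertical
direction of `S → 𝒩` is spanned by the class of `t k`. -/
abbrev ScaledGeodesicTangent (g : LorentzMetric E M) (γ : ℝ → M) (I : Set ℝ) :=
  nullJacobi g γ I ⧸ spanK g γ I

/-- The differential `T S → T 𝒩` of the projection of the symplectization. -/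
def scaleProj (g : LorentzMetric E M) (γ : ℝ → M) (I : Set ℝ) :
    ScaledGeodesicTangent g γ I →ₗ[ℝ] NullGeodesicTangent g γ I :=
  Submodule.mapQ (spanK g γ I) (spanKTK g γ I) LinearMap.id <| by
    rw [Submodule.comap_id]
    exact Submodule.comap_mono (Submodule.span_mono (by simp))

/-- The Wronskian `ω(X, Y) = g(∇_k X, Y) - g(X, ∇_k Y)` at the parameter `t`; on `𝒥` it does not
depend on `t`, and up to the scale it is the symplectic form of the symplectization. -/
def wronskian (g : LorentzMetric E M) (γ : ℝ → M)
    (X Y : ∀ t : ℝ, TangentSpace 𝓘(ℝ, E) (γ t)) (t : ℝ) : ℝ :=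
  let G := g.coeff (γ t) (extChartAt 𝓘(ℝ, E) (γ t) (γ t))
  G (covDerivCoord g γ X t) (coordRep γ Y t t) - G (coordRep γ X t t) (covDerivCoord g γ Y t)

/-- A point `η = j¹θ` of `J¹S` over `[γ]`: the value of the section `θ` of `S → 𝒩` at `[γ]`, which
is a positive covector on `T_{[γ]} 𝒩` whose kernel is the contact hyperplane `{g(k, ·) = 0}`, and
the differential at `[γ]` of that section, which is a linear section of `T S → T 𝒩`.
The positive covectors with this kernel are the covectors `X ↦ scale * g(γ', X)`, `scale > 0`; so
the value of `θ` amounts to the rescaled tangent `scale • γ'`. -/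
structure ContactScaleJet (g : LorentzMetric E M) (γ : ℝ → M) (I : Set ℝ) where
  covector : NullGeodesicTangent g γ I →ₗ[ℝ] ℝ
  scale : ℝ
  scale_pos : 0 < scale
  covector_apply : ∀ (X : nullJacobi g γ I), ∀ t ∈ I,
    covector (Submodule.Quotient.mk X) = scale * g.toFun (γ t) (velocity γ t) (X.1 t)
  lift : NullGeodesicTangent g γ I →ₗ[ℝ] ScaledGeodesicTangent g γ I
  proj_lift : ∀ X, scaleProj g γ I (lift X) = X

/-- `R` is the Reeb direction of `η = j¹θ` at `[γ]`: `θ(R) = 1` and `dθ(R, ·) = 0`, where `dθ` is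
the pullback by the section `θ` of the symplectic form of the symplectization. -/
def ContactScaleJet.IsReeb {g : LorentzMetric E M} {γ : ℝ → M} {I : Set ℝ}
    (η : ContactScaleJet g γ I) (R : NullGeodesicTangent g γ I) : Prop :=
  η.covector R = 1 ∧
  ∀ (Z : NullGeodesicTangent g γ I) (X Y : nullJacobi g γ I),
    Submodule.Quotient.mk X = η.lift R → Submodule.Quotient.mk Y = η.lift Z →
      ∀ t ∈ I, wronskian g γ X.1 Y.1 t = 0

end Contact

/-! ### Weighted coordinates -/

/-- The coordinates `(u, x, v)`, of weights `0, 1, 2`. -/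
abbrev Coord (n : ℕ) := ℝ × EuclideanSpace ℝ (Fin n) × ℝ

/-- The dilation `δ_ε (u, x, v) = (u, ε x, ε² v)`. -/
def dil {n : ℕ} (ε : ℝ) (p : Coord n) : Coord n := (p.1, ε • p.2.1, ε ^ 2 * p.2.2)

/-- The points `(u, x, v)` with `u ∈ J`. -/
def slab (n : ℕ) (J : Set ℝ) : Set (Coord n) := {p | p.1 ∈ J}

/-- The point `(u, 0, 0)` of the axis. -/
def axisPt (n : ℕ) (u : ℝ) : Coord n := (u, 0, 0)

/-- Fields of bilinear forms on the coordinate space. -/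
abbrev TensorField (n : ℕ) := Coord n → (Coord n →L[ℝ] Coord n →L[ℝ] ℝ)

/-- The pullback `f^* q` of a field of bilinear forms. -/
def pullTensor {n : ℕ} (f : Coord n → Coord n) (q : TensorField n) : TensorField n :=
  fun p => (q (f p)).bilinearComp (fderiv ℝ f p) (fderiv ℝ f p)

/-- `F ε → F₀` as `ε → 0⁺`, uniformly with all derivatives on every compact subset of `U`. -/
def SmoothConv {n : ℕ} {A : Type*} [NormedAddCommGroup A] [NormedSpace ℝ A]
    (F : ℝ → Coord n → A) (F₀ : Coord n → A) (U : Set (Coord n)) : Prop :=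
  ∀ K ⊆ U, IsCompact K → ∀ m : ℕ,
    TendstoUniformlyOn (fun ε p => iteratedFDeriv ℝ m (F ε) p) (iteratedFDeriv ℝ m F₀)
      (𝓝[>] (0 : ℝ)) K

/-- The coordinate directions of weight `0` (`u`), `1` (`x`) and `2` (`v`). -/
def HasWeight {n : ℕ} (w : Coord n) : ℕ → Prop
  | 0 => w.2 = 0
  | 1 => w.1 = 0 ∧ w.2.2 = 0
  | 2 => w.1 = 0 ∧ w.2.1 = 0
  | _ => w = 0

/-- `f = O_w(r)` along the axis over `J`: the Taylor expansion of `f` along the axis has no term of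
weight less than `r`. -/
def WeightedOrder {n : ℕ} {A : Type*} [NormedAddCommGroup A] [NormedSpace ℝ A]
    (J : Set ℝ) (r : ℕ) (f : Coord n → A) : Prop :=
  ∀ u ∈ J, ∀ (m : ℕ) (w : Fin m → Coord n) (d : Fin m → ℕ), (∀ i, HasWeight (w i) (d i)) →
    ∑ i, d i < r → iteratedFDeriv ℝ m f (axisPt n u) w = 0

/-- The field `h` of bilinear forms has weighted order at least `r` along the axis over `J`, where
`du, dx, dv` have the weights `0, 1, 2`. -/
def TensorWeightedOrder {n : ℕ} (J : Set ℝ) (r : ℕ) (h : TensorField n) : Prop :=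
  ∀ (i j : ℕ) (a b : Coord n), HasWeight a i → HasWeight b j →
    WeightedOrder J (r - i - j) (fun p => h p a b)

/-- On `J × ℝⁿ × ℝ`, the field `q` is a plane-wave metric `2 du dv + C_{ij}(u) dx^i dx^j` with `C`
smooth and positive definite. -/
def IsRosen {n : ℕ} (J : Set ℝ) (q : TensorField n) : Prop :=
  ∃ C : ℝ → (EuclideanSpace ℝ (Fin n) →L[ℝ] EuclideanSpace ℝ (Fin n) →L[ℝ] ℝ),
    ContDiffOn ℝ ∞ C J ∧
    (∀ u ∈ J, (∀ ξ ζ, C u ξ ζ = C u ζ ξ) ∧ ∀ ξ, ξ ≠ 0 → 0 < C u ξ ξ) ∧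
    ∀ p ∈ slab n J, ∀ a b : Coord n,
      q p a b = a.1 * b.2.2 + a.2.2 * b.1 + C p.1 a.2.1 b.2.1

/-- `f` and its inverse are smooth. -/
def SmoothBothWays {n : ℕ} {E : Type*} [NormedAddCommGroup E] [NormedSpace ℝ E]
    {M : Type*} [TopologicalSpace M] [ChartedSpace E M]
    (f : OpenPartialHomeomorph (Coord n) M) : Prop :=
  ContMDiffOn 𝓘(ℝ, Coord n) 𝓘(ℝ, E) ∞ f f.source ∧
  ContMDiffOn 𝓘(ℝ, E) 𝓘(ℝ, Coord n) ∞ f.symm f.target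

/-! ### Adapted charts -/

section Adapted

variable {n : ℕ} {M : Type u} [TopologicalSpace M]
  [ChartedSpace (EuclideanSpace ℝ (Fin (n + 2))) M]
  [IsManifold 𝓘(ℝ, EuclideanSpace ℝ (Fin (n + 2))) ∞ M]
  {g : LorentzMetric (EuclideanSpace ℝ (Fin (n + 2))) M} {γ : ℝ → M} {I : Set ℝ}

/-- A local `η`-adapted realizing chart `Φ : (u, x, v) ↦ M`: it sends the axis `{x = v = 0}`, over
an open interval `axis`, to `γ`, where `u` is an affine parameter with
`Φ_* ∂_u = η.scale • γ'` (the normalization of the tangent given by `η`); the metric has the form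
`Φ^* g = 2 du dv + A dv² + 2 B_i dv dx^i + C_{ij} dx^i dx^j`; and along the axis the Jacobi field
`Φ_* ∂_v` represents the Reeb direction of `η`. -/
structure AdaptedChart (η : ContactScaleJet g γ I) where
  chart : OpenPartialHomeomorph (Coord n) M
  smooth : SmoothBothWays (E := EuclideanSpace ℝ (Fin (n + 2))) chart
  axis : Set ℝ
  axis_isOpen : IsOpen axis
  axis_ordConnected : axis.OrdConnected
  axis_nonempty : axis.Nonempty
  axis_mem : ∀ u ∈ axis, axisPt n u ∈ chart.source
  /-- The origin of the affine parameter `u` is arbitrary. -/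
  shift : ℝ
  axis_param : ∀ u ∈ axis, η.scale * (u + shift) ∈ I ∧
    chart (axisPt n u) = γ (η.scale * (u + shift))
  metric_uu : ∀ p ∈ chart.source, g.pullback chart p (1, 0, 0) (1, 0, 0) = 0
  metric_uv : ∀ p ∈ chart.source, g.pullback chart p (1, 0, 0) (0, 0, 1) = 1
  metric_ux : ∀ p ∈ chart.source, ∀ ξ : EuclideanSpace ℝ (Fin n),
    g.pullback chart p (1, 0, 0) (0, ξ, 0) = 0
  reeb : ∃ R : nullJacobi g γ I, η.IsReeb (Submodule.Quotient.mk R) ∧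
    ∀ u ∈ axis, tangentMapAt (E := EuclideanSpace ℝ (Fin (n + 2))) chart (axisPt n u) (0, 0, 1) =
      R.1 (η.scale * (u + shift))

namespace AdaptedChart

variable {η : ContactScaleJet g γ I}

/-- The rescaled metrics `ε⁻² δ_ε^* (Φ^* g)`. -/
def rescaled (Φ : AdaptedChart η) (ε : ℝ) : TensorField n :=
  fun p => (ε ^ 2)⁻¹ • pullTensor (dil ε) (g.pullback Φ.chart) p

/-- The rescaled metrics converge smoothly on compact sets to `q`. -/
def LimitsTo (Φ : AdaptedChart η) (q : TensorField n) : Prop :=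
  SmoothConv Φ.rescaled q (slab n Φ.axis)

/-- `Φ^* g = q + h` with `h` of weighted order strictly higher than the order `2` of `q`. -/
def LeadingTerm (Φ : AdaptedChart η) (q : TensorField n) : Prop :=
  TensorWeightedOrder Φ.axis 3 (fun p => g.pullback Φ.chart p - q p)

/-- The transition map `ψ = Φ'⁻¹ ∘ Φ`. -/
def transition (Φ Φ' : AdaptedChart η) (p : Coord n) : Coord n := Φ'.chart.symm (Φ.chart p)

/-- The parameters of the axis of `Φ` whose points on `γ` lie also on the axis of `Φ'`. -/
def overlap (Φ Φ' : AdaptedChart η) : Set ℝ :=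
  {s | s ∈ Φ.axis ∧ s + Φ.shift - Φ'.shift ∈ Φ'.axis}

/-- The conjugate `δ_ε⁻¹ ∘ ψ ∘ δ_ε` of the transition map. -/
def conjTransition (Φ Φ' : AdaptedChart η) (ε : ℝ) (p : Coord n) : Coord n :=
  dil ε⁻¹ (transition Φ Φ' (dil ε p))

/-- The leading part `ψ₀ = lim_{ε → 0} δ_ε⁻¹ ∘ ψ ∘ δ_ε` of the transition map. -/
def leadingPart (Φ Φ' : AdaptedChart η) (p : Coord n) : Coord n :=
  limUnder (𝓝[>] (0 : ℝ)) (fun ε => conjTransition Φ Φ' ε p)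

/-- The two charts are compatibly normalized along `γ`: they use the same affine parameter, and
along `γ` their coordinate fields `∂_{x^i}` agree modulo `γ'`, so that they induce the same frame of
the screen bundle. -/
def CompatiblyNormalized (Φ Φ' : AdaptedChart η) : Prop :=
  Φ.shift = Φ'.shift ∧
  ∀ s ∈ overlap Φ Φ', ∀ ξ : EuclideanSpace ℝ (Fin n), ∃ r : ℝ,
    tangentMapAt (E := EuclideanSpace ℝ (Fin (n + 2))) Φ.chart (axisPt n s) (0, ξ, 0) =
      tangentMapAt (E := EuclideanSpace ℝ (Fin (n + 2))) Φ'.chart (axisPt n s) (0, ξ, 0) +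
        r • tangentMapAt (E := EuclideanSpace ℝ (Fin (n + 2))) Φ.chart (axisPt n s) (1, 0, 0)

end AdaptedChart

end Adapted

/-! ### Plane-wave germs -/

/-- A plane-wave germ with a distinguished null geodesic `Γ`: a Lorentzian manifold (of which only
a neighbourhood of `Γ` matters) and an affinely parametrized null geodesic `Γ` in it, such that
around each point of `Γ` there are coordinates `(u, x, v)`, with domain `J × ℝⁿ × ℝ`, in which the
metric is `2 du dv + C_{ij}(u) dx^i dx^j` and `Γ` is `u ↦ (u, 0, 0)`. -/
structure PlaneWaveGerm (n : ℕ) where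
  carrier : Type u
  [top : TopologicalSpace carrier]
  [t2 : T2Space carrier]
  [secondCountable : SecondCountableTopology carrier]
  [charted : ChartedSpace (Coord n) carrier]
  [isManifold : IsManifold 𝓘(ℝ, Coord n) ∞ carrier]
  metric : LorentzMetric (Coord n) carrier
  Γ : ℝ → carrier
  domain : Set ℝ
  nullGeodesic : IsNullGeodesicOn metric Γ domain
  planeWave : ∀ s ∈ domain, ∃ (J : Set ℝ) (f : OpenPartialHomeomorph (Coord n) carrier),
    s ∈ J ∧ J ⊆ domain ∧ IsOpen J ∧ J.OrdConnected ∧ f.source = slab n J ∧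
    SmoothBothWays (E := Coord n) f ∧ IsRosen J (metric.pullback f) ∧
    ∀ r ∈ J, f (axisPt n r) = Γ r

attribute [instance] PlaneWaveGerm.top PlaneWaveGerm.t2 PlaneWaveGerm.secondCountable
  PlaneWaveGerm.charted PlaneWaveGerm.isManifold

section Realization

variable {n : ℕ} {M : Type u} [TopologicalSpace M]
  [ChartedSpace (EuclideanSpace ℝ (Fin (n + 2))) M]
  [IsManifold 𝓘(ℝ, EuclideanSpace ℝ (Fin (n + 2))) ∞ M]
  {g : LorentzMetric (EuclideanSpace ℝ (Fin (n + 2))) M} {γ : ℝ → M} {I : Set ℝ}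

/-- The plane-wave germ `P` is the limit of the rescaled metrics in every `η`-adapted chart: each
such chart `Φ` with axis `J` gives coordinates `ι Φ` on `P`, with domain `J × ℝⁿ × ℝ`, which send
the axis to `Γ` and in which the metric of `P` is the limit of the rescaled metrics, equivalently
the weighted leading term of `Φ^* g`; and the coordinates that come from two charts are related
exactly by the leading part of the transition map. -/
structure IsPenroseLimit (η : ContactScaleJet g γ I) (P : PlaneWaveGerm.{u} n)
    (ι : AdaptedChart η → OpenPartialHomeomorph (Coord n) P.carrier) : Prop where
  domain_eq : P.domain = {s | ∃ Φ : AdaptedChart η, s - Φ.shift ∈ Φ.axis}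
  source_eq : ∀ Φ, (ι Φ).source = slab n Φ.axis
  smooth : ∀ Φ, SmoothBothWays (E := Coord n) (ι Φ)
  axis : ∀ Φ, ∀ s ∈ Φ.axis, ι Φ (axisPt n s) = P.Γ (s + Φ.shift)
  rosen : ∀ Φ, IsRosen Φ.axis (P.metric.pullback (ι Φ))
  limit : ∀ Φ : AdaptedChart η, Φ.LimitsTo (P.metric.pullback (ι Φ))
  leadingTerm : ∀ Φ : AdaptedChart η, Φ.LeadingTerm (P.metric.pullback (ι Φ))
  glue : ∀ Φ Φ' p p', p ∈ slab n Φ.axis → p' ∈ slab n Φ'.axis →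
    (ι Φ p = ι Φ' p' ↔
      p.1 + Φ.shift = p'.1 + Φ'.shift ∧ p' = AdaptedChart.leadingPart Φ Φ' p)

/-- `F` is an isometry from the germ of `P` along `Γ` to the germ of `P'` along `Γ'`, defined on
the union of the coordinate domains `ι Φ`, and it is compatible with the coordinates `ι Φ` and
`ι' Φ` which come from the adapted charts. -/
structure IsCanonicalIsometry {η : ContactScaleJet g γ I} {P P' : PlaneWaveGerm.{u} n}
    (ι : AdaptedChart η → OpenPartialHomeomorph (Coord n) P.carrier)
    (ι' : AdaptedChart η → OpenPartialHomeomorph (Coord n) P'.carrier)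
    (F : OpenPartialHomeomorph P.carrier P'.carrier) : Prop where
  source_eq : F.source = ⋃ Φ, (ι Φ).target
  target_eq : F.target = ⋃ Φ, (ι' Φ).target
  smooth : ContMDiffOn 𝓘(ℝ, Coord n) 𝓘(ℝ, Coord n) ∞ F F.source
  smooth_symm : ContMDiffOn 𝓘(ℝ, Coord n) 𝓘(ℝ, Coord n) ∞ F.symm F.target
  isometry : ∀ x ∈ F.source, ∀ a b : TangentSpace 𝓘(ℝ, Coord n) x,
    P'.metric.toFun (F x) (mfderiv 𝓘(ℝ, Coord n) 𝓘(ℝ, Coord n) F x a)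
      (mfderiv 𝓘(ℝ, Coord n) 𝓘(ℝ, Coord n) F x b) = P.metric.toFun x a b
  comp : ∀ Φ, ∀ p ∈ slab n Φ.axis, F (ι Φ p) = ι' Φ p
  axis : P.domain = P'.domain ∧ ∀ s ∈ P.domain, P.Γ s ∈ F.source ∧ F (P.Γ s) = P'.Γ s

end Realization

end

/-! The conditions on an adapted chart say that `g(∂_u, ·) = dv`: the `u`-direction is null and
metrically dual to `v`. Everything follows from this and from the homogeneity of plane waves.

Metric. A vector dilated by `δ_ε` is `a_u ∂_u + ε L_ε a` with `L_ε a = (0, a_x, ε a_v)`. Because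
`g(∂_u, ∂_u) = 0` and `g(∂_u, L_ε a) = ε a_v`, the factor `ε⁻²` cancels exactly, and the rescaled
metric is `a_u b_v + a_v b_u + g(L_ε a, L_ε b)` at `δ_ε p`. This is smooth through `ε = 0`, where
only the coefficients `C_{ij}(u)` on the axis survive (`extendsSmoothly_rescaled`). They are
positive definite because a vector orthogonal to a null vector and not proportional to it is
spacelike. Joint smoothness in `(ε, p)` gives convergence of all derivatives on compact sets
(`ExtendsSmoothly.smoothConv`). A plane-wave metric `q` satisfies `δ_ε^* q = ε² q`, so convergence
to `q` amounts to the vanishing of all terms of `Φ^* g - q` of weight at most 2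
(`weightedOrder_of_smoothConv`).

Transition maps. Both charts follow `γ` with the same normalization of the tangent, so `ψ`
translates the axis and `dψ` fixes `∂_u`. Hence the `x`-part of `ψ` vanishes on the axis. By duality
of `∂_u` and `dv`, the `v`-part has zero derivative there in the `x`-directions. Hadamard's lemma,
used once for `x` and twice for `v`, then shows that `δ_ε⁻¹ ∘ ψ ∘ δ_ε` extends smoothly to `ε = 0`
(`exists_extendsSmoothly_conjTransition`). The cocycle law, invertibility and the isometry property
hold before the limit for small `ε` and pass to it. If the screen frames agree, then `ψ₀` fixes `u`
and `x`; the isometry property forces `d(v ∘ ψ₀) = dv`, and since the axis is fixed, `ψ₀ = id`.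

Germ. The limits `ψ₀` form a cocycle of isometries that respects the affine parameter on `γ`, so the
plane waves of all adapted charts glue to one manifold (`RosenAtlas`). The gluing rule determines
which coordinates name the same point, and this gives the unique canonical isometry. -/

noncomputable section

/-! ### Hadamard's lemma and smooth dependence on a parameter -/

section Hadamard

open MeasureTheory

variable {F A : Type*} [NormedAddCommGroup F] [NormedSpace ℝ F]
  [NormedAddCommGroup A] [NormedSpace ℝ A]

/-- The integral is the value at `0` of a convolution of the indicator of `(0, 1]` with a compactly
supported kernel depending on the parameter `z`, and such convolutions are smooth in `z`. The bump
`χ` is `1` on `[-1, 1]` and `0` outside `[-2, 2]`, so only `|t| < 3` matters; the radius `r / 3`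
keeps `t * z.1` in range. -/
theorem exists_contDiffOn_integral_ball [CompleteSpace A] {f : ℝ × F → A} {p₀ : F} {r : ℝ}
    (hr : 0 < r)
    (hf : ContDiffOn ℝ ∞ f (Metric.ball (0, p₀) r)) :
    ContDiffOn ℝ ∞ (fun z : ℝ × F => ∫ t in (0 : ℝ)..1, f (t * z.1, z.2))
      (Metric.ball (0, p₀) (r / 3)) := by
  let χ : ContDiffBump (0 : ℝ) := ⟨1, 2, one_pos, one_lt_two⟩
  have hχ : ContDiff ℝ ∞ χ := χ.contDiff
  have hmem : ∀ z ∈ Metric.ball ((0 : ℝ), p₀) (r / 3), ∀ t : ℝ, |t| < 3 →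
      (t * z.1, z.2) ∈ Metric.ball ((0 : ℝ), p₀) r := by
    intro z hz t ht
    rw [Metric.mem_ball, Prod.dist_eq, max_lt_iff] at hz ⊢
    simp only [Real.dist_eq, sub_zero] at hz ⊢
    refine ⟨?_, by linarith [hz.2]⟩
    rw [abs_mul]
    nlinarith [abs_nonneg t, abs_nonneg z.1, hz.1]
  -- The convolution evaluates its kernel at `0 - t`, which accounts for the sign of `t`.
  let G : ℝ × F → ℝ → A := fun z t => χ t • f (-t * z.1, z.2)
  have hG : ContDiffOn ℝ ∞ (Function.uncurry G) (Metric.ball ((0 : ℝ), p₀) (r / 3) ×ˢ univ) := by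
    rintro ⟨z, t⟩ ⟨hz, -⟩
    apply ContDiffAt.contDiffWithinAt
    by_cases ht : |t| < 3
    · have h1 : ContDiffAt ℝ ∞ f (-t * z.1, z.2) :=
        hf.contDiffAt (Metric.isOpen_ball.mem_nhds (hmem z hz (-t) (by rwa [abs_neg])))
      have h2 : ContDiffAt ℝ ∞ (fun y : (ℝ × F) × ℝ => (-y.2 * y.1.1, y.1.2)) (z, t) := by
        fun_prop
      have h3 : ContDiffAt ℝ ∞ (fun y : (ℝ × F) × ℝ => χ y.2) (z, t) :=
        (hχ.comp contDiff_snd).contDiffAt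
      exact h3.smul (ContDiffAt.comp (z, t) h1 h2)
    · have h0 : (Function.uncurry G) =ᶠ[𝓝 (z, t)] fun _ => 0 := by
        have : {y : (ℝ × F) × ℝ | 2 < |y.2|} ∈ 𝓝 (z, t) :=
          (isOpen_lt continuous_const (by fun_prop)).mem_nhds (by simp only [mem_ofPred_eq]; linarith)
        filter_upwards [this] with y hy
        have : χ y.2 = 0 := χ.zero_of_le_dist (by simpa [χ] using le_of_lt hy)
        simp [Function.uncurry, G, this]
      exact contDiffAt_const.congr_of_eventuallyEq h0
  have key := contDiffOn_convolution_right_with_param_comp (n := ⊤) (μ := volume)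
    (ContinuousLinearMap.lsmul ℝ ℝ) (v := fun _ : ℝ × F => (0 : ℝ)) contDiffOn_const
    (f := indicator (Ioc (0 : ℝ) 1) 1) (g := G) (k := Metric.closedBall 0 2)
    Metric.isOpen_ball (isCompact_closedBall (0 : ℝ) 2)
    (fun z t _ ht => by
      have : χ t = 0 := χ.zero_of_le_dist (by
        rw [Metric.mem_closedBall, not_le] at ht; exact ht.le)
      simp [G, this])
    ((integrable_indicator_iff measurableSet_Ioc).2 (by simp [Pi.one_def])).locallyIntegrable hG
  refine key.congr fun z _ => ?_
  rw [convolution_def, intervalIntegral.integral_of_le zero_le_one,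
    ← integral_indicator measurableSet_Ioc]
  congr 1
  funext t
  by_cases ht : t ∈ Ioc (0 : ℝ) 1
  · have : χ (-t) = 1 := χ.one_of_mem_closedBall (by
      simp only [Metric.mem_closedBall, Real.dist_eq, sub_zero, abs_neg, χ]
      rw [abs_of_pos ht.1]; exact ht.2)
    simp [ht, G, this]
  · simp [ht]

/-- **Hadamard's lemma**: a smooth function of `(ε, p)` vanishing at `ε = 0` is `ε` times a smooth
function. -/
theorem exists_contDiffOn_eq_smul [CompleteSpace A] {Ω : Set (ℝ × F)} (hΩ : IsOpen Ω) {f : ℝ × F → A}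
    (hf : ContDiffOn ℝ ∞ f Ω) (h0 : ∀ p, ((0 : ℝ), p) ∈ Ω → f (0, p) = 0) :
    ∃ f₁ : ℝ × F → A, ContDiffOn ℝ ∞ f₁ Ω ∧ (∀ z ∈ Ω, f z = z.1 • f₁ z) ∧
      ∀ p, ((0 : ℝ), p) ∈ Ω → f₁ (0, p) = fderiv ℝ f (0, p) (1, 0) := by
  classical
  let f₁ : ℝ × F → A := fun z => if z.1 = 0 then fderiv ℝ f z (1, 0) else z.1⁻¹ • f z
  refine ⟨f₁, ?_, ?_, ?_⟩
  · rintro ⟨ε, p⟩ hz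
    apply ContDiffAt.contDiffWithinAt
    by_cases hε : ε = 0
    · subst hε
      obtain ⟨r, hr, hball⟩ := Metric.isOpen_iff.1 hΩ _ hz
      let k : ℝ × F → A := fun z => fderiv ℝ f z (1, 0)
      have hk : ContDiffOn ℝ ∞ k (Metric.ball (0, p) r) :=
        ((hf.mono hball).fderiv_of_isOpen Metric.isOpen_ball (by simp)).clm_apply contDiffOn_const
      have hI := exists_contDiffOn_integral_ball hr hk
      have hr3 : 0 < r / 3 := by positivity
      refine (hI.contDiffAt (Metric.ball_mem_nhds _ hr3)).congr_of_eventuallyEq ?_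
      -- Near `ε = 0` the quotient coincides with `∫₀¹ ∂_ε f(tε, p) dt`, by the fundamental theorem
      -- of calculus along the segment from `(0, p)` to `(ε, p)`.
      filter_upwards [Metric.ball_mem_nhds ((0 : ℝ), p) hr3] with z hz'
      by_cases hz1 : z.1 = 0
      · have hf₁ : f₁ z = k z := if_pos hz1
        simp only [hf₁, hz1, mul_zero]
        rw [intervalIntegral.integral_const, sub_zero, one_smul, ← hz1]
      · simp only [f₁, hz1, if_false]
        have hm : ∀ t ∈ uIcc (0 : ℝ) 1, (t * z.1, z.2) ∈ Metric.ball ((0 : ℝ), p) r := by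
          intro t ht
          rw [uIcc_of_le zero_le_one] at ht
          rw [Metric.mem_ball, Prod.dist_eq, max_lt_iff] at hz' ⊢
          simp only [Real.dist_eq, sub_zero] at hz' ⊢
          refine ⟨?_, by linarith [hz'.2]⟩
          rw [abs_mul, abs_of_nonneg ht.1]
          nlinarith [abs_nonneg z.1, hz'.1, ht.1, ht.2]
        have hd : ∀ t ∈ uIcc (0 : ℝ) 1,
            HasDerivAt (fun t => f (t * z.1, z.2)) (z.1 • k (t * z.1, z.2)) t := by
          intro t ht
          have hfd : HasFDerivAt f (fderiv ℝ f (t * z.1, z.2)) (t * z.1, z.2) :=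
            ((hf.contDiffAt (hΩ.mem_nhds (hball (hm t ht)))).differentiableAt
              (by simp)).hasFDerivAt
          have hl : HasDerivAt (fun t : ℝ => (t * z.1, z.2)) (z.1, 0) t := by
            simpa using ((hasDerivAt_id t).mul_const z.1).prodMk (hasDerivAt_const t z.2)
          have := hfd.comp_hasDerivAt t hl
          have hk1 : fderiv ℝ f (t * z.1, z.2) (z.1, 0) = z.1 • k (t * z.1, z.2) := by
            change _ = z.1 • fderiv ℝ f (t * z.1, z.2) (1, 0)
            rw [← map_smul]
            simp
          rw [hk1] at this
          exact this
        have hc : ContinuousOn (fun t => k (t * z.1, z.2)) (uIcc (0 : ℝ) 1) :=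
          hk.continuousOn.comp (by fun_prop) hm
        have hint := intervalIntegral.integral_eq_sub_of_hasDerivAt hd
          ((hc.const_smul z.1).intervalIntegrable)
        rw [intervalIntegral.integral_smul] at hint
        have hz0 : f (0 * z.1, z.2) = 0 := by
          rw [zero_mul]
          refine h0 _ (hball ?_)
          have := hm 0 (by simp)
          rwa [zero_mul] at this
        rw [hz0, sub_zero, one_mul] at hint
        rw [← Prod.mk.eta (p := z)]
        dsimp only
        rw [← hint, smul_smul, inv_mul_cancel₀ hz1, one_smul]
    · have : ContDiffAt ℝ ∞ (fun z : ℝ × F => z.1⁻¹ • f z) (ε, p) :=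
        (contDiffAt_fst.inv hε).smul (hf.contDiffAt (hΩ.mem_nhds hz))
      refine this.congr_of_eventuallyEq ?_
      filter_upwards [(isOpen_ne.preimage continuous_fst).mem_nhds
        (show (ε, p) ∈ Prod.fst ⁻¹' {x : ℝ | x ≠ 0} from hε)] with z hz'
      have hz' : z.1 ≠ 0 := hz'
      simp [f₁, hz']
  · rintro ⟨ε, p⟩ hz
    by_cases hε : ε = 0
    · subst hε; simp [h0 p hz]
    · simp [f₁, hε]
  · intro p _
    simp [f₁]

end Hadamard

/-! ### Convergence with all derivatives -/

section SmoothConv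

variable {n : ℕ} {A : Type*} [NormedAddCommGroup A] [NormedSpace ℝ A]

/-- The family `F ε`, `ε > 0`, extends smoothly in all variables to `ε = 0`, with the value `F₀`
there. -/
def ExtendsSmoothly (F : ℝ → Coord n → A) (F₀ : Coord n → A) (U : Set (Coord n)) : Prop :=
  ∃ (Ω : Set (ℝ × Coord n)) (G : ℝ × Coord n → A), IsOpen Ω ∧ ContDiffOn ℝ ∞ G Ω ∧
    (∀ p ∈ U, ((0 : ℝ), p) ∈ Ω ∧ G (0, p) = F₀ p) ∧ ∀ z ∈ Ω, 0 < z.1 → F z.1 z.2 = G z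

/-- Derivatives in `p` alone are restrictions of the full derivatives in `(ε, p)`, so they are
jointly continuous in `(ε, p)`. -/
theorem iteratedFDeriv_slice {F : Type*} [NormedAddCommGroup F] [NormedSpace ℝ F]
    {Ω : Set (ℝ × F)} (hΩ : IsOpen Ω) {G : ℝ × F → A}
    (hG : ContDiffOn ℝ ∞ G Ω) (m : ℕ) {z : ℝ × F} (hz : z ∈ Ω) :
    iteratedFDeriv ℝ m (fun p => G (z.1, p)) z.2 =
      (iteratedFDeriv ℝ m G z).compContinuousLinearMap
        (fun _ => ContinuousLinearMap.inr ℝ ℝ F) := by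
  -- Translating by `(z.1, 0)` turns the affine inclusion of the slice into the linear map `inr`, so
  -- that the chain rule for linear maps applies.
  let T : ℝ × F → A := fun w => G ((z.1, 0) + w)
  let V : Set (ℝ × F) := (fun w => (z.1, 0) + w) ⁻¹' Ω
  have hV : IsOpen V := hΩ.preimage (by fun_prop)
  have hT : ContDiffOn ℝ ∞ T V :=
    hG.comp (contDiff_const.add contDiff_id).contDiffOn (fun _ h => h)
  let i := ContinuousLinearMap.inr ℝ ℝ F
  have hiV : IsOpen (i ⁻¹' V) := hV.preimage i.continuous
  have hmem : i z.2 ∈ V := by simp [V, i, hz]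
  have key := i.iteratedFDerivWithin_comp_right hT hV.uniqueDiffOn hiV.uniqueDiffOn hmem
    (i := m) (by exact_mod_cast le_top)
  rw [iteratedFDerivWithin_of_isOpen m hiV hmem, iteratedFDerivWithin_of_isOpen m hV hmem] at key
  have e1 : T ∘ i = fun p => G (z.1, p) := by
    funext p; simp [T, i]
  have e2 : iteratedFDeriv ℝ m T (i z.2) = iteratedFDeriv ℝ m G z := by
    have := iteratedFDeriv_comp_add_left (𝕜 := ℝ) (f := G) m (z.1, 0) (i z.2)
    simpa [i] using this
  rw [e1, e2] at key
  exact key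

theorem continuousOn_iteratedFDeriv_slice {F : Type*} [NormedAddCommGroup F] [NormedSpace ℝ F]
    {Ω : Set (ℝ × F)} (hΩ : IsOpen Ω)
    {G : ℝ × F → A} (hG : ContDiffOn ℝ ∞ G Ω) (m : ℕ) :
    ContinuousOn (fun z : ℝ × F => iteratedFDeriv ℝ m (fun p => G (z.1, p)) z.2) Ω := by
  have h1 : ContinuousOn (iteratedFDeriv ℝ m G) Ω :=
    (hG.continuousOn_iteratedFDerivWithin (m := m) (by exact_mod_cast le_top)
      hΩ.uniqueDiffOn).congr fun z hz => (iteratedFDerivWithin_of_isOpen m hΩ hz).symm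
  have h2 := (ContinuousMultilinearMap.compContinuousLinearMapL (F := A)
    (fun _ : Fin m => ContinuousLinearMap.inr ℝ ℝ F)).continuous.comp_continuousOn h1
  exact h2.congr fun z hz => iteratedFDeriv_slice hΩ hG m hz

namespace ExtendsSmoothly

variable {F : ℝ → Coord n → A} {F₀ : Coord n → A} {U : Set (Coord n)}

theorem contDiffOn (h : ExtendsSmoothly F F₀ U) : ContDiffOn ℝ ∞ F₀ U := by
  obtain ⟨Ω, G, -, hG, h0, -⟩ := h
  have : ContDiffOn ℝ ∞ (fun p => G (0, p)) U :=
    hG.comp (contDiff_const.prodMk contDiff_id).contDiffOn (fun p hp => (h0 p hp).1)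
  exact this.congr fun p hp => (h0 p hp).2.symm

/-- Each derivative in `p` is continuous in `(ε, p)` up to `ε = 0`. The values at `(ε, y)` and `(0,
y)` are both close to the value at `(0, x)`, which gives locally uniform convergence, hence uniform
convergence on compact sets. -/
theorem smoothConv (hU : IsOpen U) (h : ExtendsSmoothly F F₀ U) : SmoothConv F F₀ U := by
  obtain ⟨Ω, G, hΩ, hG, h0, hF⟩ := h
  intro K hKU hK m
  have hcont := continuousOn_iteratedFDeriv_slice hΩ hG m
  rw [← tendstoLocallyUniformlyOn_iff_tendstoUniformlyOn_of_compact hK,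
    Metric.tendstoLocallyUniformlyOn_iff]
  intro e he x hx
  have hx0 := (h0 x (hKU hx)).1
  have hca := hcont.continuousAt (hΩ.mem_nhds hx0)
  have hev := (Metric.tendsto_nhds.1 hca (e / 2) (half_pos he)).and (hΩ.mem_nhds hx0)
  rw [nhds_prod_eq] at hev
  obtain ⟨s, hs, t, ht, hst⟩ := mem_prod_iff.1 hev
  refine ⟨t ∩ U, mem_nhdsWithin_of_mem_nhds (inter_mem ht (hU.mem_nhds (hKU hx))), ?_⟩
  filter_upwards [mem_nhdsWithin_of_mem_nhds hs, self_mem_nhdsWithin] with ε hε hpos y hy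
  have a1 := hst (mk_mem_prod hε hy.1)
  have a0 := hst (mk_mem_prod (mem_of_mem_nhds hs) hy.1)
  have e1 : iteratedFDeriv ℝ m (F ε) y = iteratedFDeriv ℝ m (fun p => G (ε, p)) y := by
    refine Filter.EventuallyEq.eq_of_nhds (Filter.EventuallyEq.iteratedFDeriv ℝ ?_ m)
    have : (fun p : Coord n => (ε, p)) ⁻¹' Ω ∈ 𝓝 y :=
      (hΩ.preimage (by fun_prop)).mem_nhds a1.2
    filter_upwards [this] with p hp using hF (ε, p) hp hpos
  have e0 : iteratedFDeriv ℝ m F₀ y = iteratedFDeriv ℝ m (fun p => G (0, p)) y := by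
    refine Filter.EventuallyEq.eq_of_nhds (Filter.EventuallyEq.iteratedFDeriv ℝ ?_ m)
    filter_upwards [hU.mem_nhds hy.2] with p hp using (h0 p hp).2.symm
  rw [e1, e0]
  calc _ ≤ dist _ (iteratedFDeriv ℝ m (fun p => G (0, p)) x) +
          dist (iteratedFDeriv ℝ m (fun p => G (ε, p)) y) _ := by
        rw [dist_comm (iteratedFDeriv ℝ m (fun p => G (ε, p)) y)]; exact dist_triangle _ _ _
    _ < e / 2 + e / 2 := add_lt_add a0.1 a1.1
    _ = e := add_halves e

/-- The point of evaluation may move with `ε`. This is what compositions `F ε (φ ε)` need, both in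
the cocycle law and in the pullback of the rescaled metrics. -/
theorem tendsto_comp (h : ExtendsSmoothly F F₀ U) {p : Coord n} (hp : p ∈ U) {φ : ℝ → Coord n}
    (hφ : Tendsto φ (𝓝[>] 0) (𝓝 p)) :
    Tendsto (fun ε => F ε (φ ε)) (𝓝[>] 0) (𝓝 (F₀ p)) := by
  obtain ⟨Ω, G, hΩ, hG, h0, hF⟩ := h
  have hmem := hΩ.mem_nhds (h0 p hp).1
  have hpair : Tendsto (fun ε => (ε, φ ε)) (𝓝[>] 0) (𝓝 (0, p)) :=
    (tendsto_nhdsWithin_of_tendsto_nhds tendsto_id).prodMk_nhds hφ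
  have := (hG.continuousOn.continuousAt hmem).tendsto.comp hpair
  rw [(h0 p hp).2] at this
  refine this.congr' ?_
  filter_upwards [hpair hmem, self_mem_nhdsWithin] with ε hε hpos
  exact (hF _ hε hpos).symm

theorem tendsto (h : ExtendsSmoothly F F₀ U) {p : Coord n} (hp : p ∈ U) :
    Tendsto (fun ε => F ε p) (𝓝[>] 0) (𝓝 (F₀ p)) :=
  h.tendsto_comp hp tendsto_const_nhds

end ExtendsSmoothly

namespace SmoothConv

variable {F : ℝ → Coord n → A} {F₀ F₀' : Coord n → A} {U : Set (Coord n)}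

theorem tendsto (h : SmoothConv F F₀ U) {p : Coord n} (hp : p ∈ U) :
    Tendsto (fun ε => F ε p) (𝓝[>] 0) (𝓝 (F₀ p)) := by
  have h1 := (h {p} (by simpa using hp) isCompact_singleton 0).tendsto_at (mem_singleton p)
  have h2 := (ContinuousMultilinearMap.apply ℝ (fun _ : Fin 0 => Coord n) A 0).continuous.tendsto _
    |>.comp h1
  simpa [Function.comp_def] using h2

theorem eqOn (h : SmoothConv F F₀ U) (h' : SmoothConv F F₀' U) : EqOn F₀ F₀' U :=
  fun _ hp => tendsto_nhds_unique (h.tendsto hp) (h'.tendsto hp)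

theorem congr_limit (hU : IsOpen U) (h : SmoothConv F F₀ U) (he : EqOn F₀ F₀' U) :
    SmoothConv F F₀' U := by
  intro K hKU hK m
  refine (h K hKU hK m).congr_right fun p hp => ?_
  refine Filter.EventuallyEq.eq_of_nhds (Filter.EventuallyEq.iteratedFDeriv ℝ ?_ m)
  filter_upwards [hU.mem_nhds (hKU hp)] with x hx using he hx

theorem tendsto_fderiv (h : SmoothConv F F₀ U) {p : Coord n} (hp : p ∈ U) :
    Tendsto (fun ε => fderiv ℝ (F ε) p) (𝓝[>] 0) (𝓝 (fderiv ℝ F₀ p)) := by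
  have h1 := (h {p} (by simpa using hp) isCompact_singleton 1).tendsto_at (mem_singleton p)
  have h2 := ((continuousMultilinearCurryFin1 ℝ (Coord n) A).continuous.tendsto _).comp h1
  have h3 : ∀ f : Coord n → A,
      continuousMultilinearCurryFin1 ℝ (Coord n) A (iteratedFDeriv ℝ 1 f p) = fderiv ℝ f p := by
    intro f
    refine ContinuousLinearMap.ext fun v => ?_
    rw [continuousMultilinearCurryFin1_apply, iteratedFDeriv_one_apply]
    simp
  simpa only [Function.comp_def, h3] using h2

end SmoothConv

end SmoothConv

/-! ### Dilations and weighted orders -/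

section Dilation

variable {n : ℕ} {A : Type*} [NormedAddCommGroup A] [NormedSpace ℝ A]

/-- The dilation `δ_ε` as a continuous linear map. -/
def dilL (n : ℕ) (ε : ℝ) : Coord n →L[ℝ] Coord n :=
  ContinuousLinearMap.prodMap (ContinuousLinearMap.id ℝ ℝ)
    (ContinuousLinearMap.prodMap (ε • ContinuousLinearMap.id ℝ (EuclideanSpace ℝ (Fin n)))
      (ε ^ 2 • ContinuousLinearMap.id ℝ ℝ))

theorem coe_dilL (ε : ℝ) : ⇑(dilL n ε) = dil ε := by
  funext p
  rfl

theorem dil_dil (a b : ℝ) (p : Coord n) : dil a (dil b p) = dil (a * b) p := by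
  simp [dil, smul_smul, mul_pow, mul_assoc]

theorem dil_one (p : Coord n) : dil 1 p = p := by simp [dil]

theorem dil_inv_dil {ε : ℝ} (hε : ε ≠ 0) (p : Coord n) : dil ε⁻¹ (dil ε p) = p := by
  rw [dil_dil, inv_mul_cancel₀ hε, dil_one]

theorem dil_dil_inv {ε : ℝ} (hε : ε ≠ 0) (p : Coord n) : dil ε (dil ε⁻¹ p) = p := by
  rw [dil_dil, mul_inv_cancel₀ hε, dil_one]

theorem dil_zero (p : Coord n) : dil 0 p = axisPt n p.1 := by simp [dil, axisPt]

theorem dil_axisPt (ε u : ℝ) : dil ε (axisPt n u) = axisPt n u := by simp [dil, axisPt]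

theorem axisPt_mem_slab {J : Set ℝ} {u : ℝ} : axisPt n u ∈ slab n J ↔ u ∈ J := Iff.rfl

theorem isOpen_slab {J : Set ℝ} (hJ : IsOpen J) : IsOpen (slab n J) :=
  hJ.preimage continuous_fst

theorem contDiff_dil : ContDiff ℝ ∞ (fun z : ℝ × Coord n => dil z.1 z.2) := by
  unfold dil
  fun_prop

/-- The dilation `δ_ε`, `ε ≠ 0`, as a linear equivalence. -/
def dilEquiv (n : ℕ) {ε : ℝ} (hε : ε ≠ 0) : Coord n ≃L[ℝ] Coord n :=
  ContinuousLinearEquiv.equivOfInverse (dilL n ε) (dilL n ε⁻¹)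
    (fun p => by rw [coe_dilL, coe_dilL, dil_inv_dil hε])
    (fun p => by rw [coe_dilL, coe_dilL, dil_dil_inv hε])

theorem HasWeight.dil_eq {w : Coord n} {d : ℕ} (h : HasWeight w d) (ε : ℝ) :
    dil ε w = ε ^ d • w := by
  obtain ⟨u, x, v⟩ := w
  match d, h with
  | 0, h => obtain ⟨rfl, rfl⟩ := Prod.mk.inj (show (x, v) = (0, 0) from h); simp [dil]
  | 1, h => obtain ⟨rfl, rfl⟩ : u = 0 ∧ v = 0 := h; simp [dil]
  | 2, h => obtain ⟨rfl, rfl⟩ : u = 0 ∧ x = 0 := h; simp [dil]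
  | d + 3, h =>
    have h : (u, x, v) = 0 := h
    rw [h]
    simp [dil]

theorem iteratedFDeriv_comp_dil {ε : ℝ} (hε : ε ≠ 0) (f : Coord n → A) (u : ℝ) {m : ℕ}
    {w : Fin m → Coord n} {d : Fin m → ℕ} (hw : ∀ i, HasWeight (w i) (d i)) :
    iteratedFDeriv ℝ m (fun p => f (dil ε p)) (axisPt n u) w =
      ε ^ (∑ i, d i) • iteratedFDeriv ℝ m f (axisPt n u) w := by
  have key := (dilEquiv n hε).iteratedFDerivWithin_comp_right f (s := univ) uniqueDiffOn_univ
    (x := axisPt n u) (mem_univ _) m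
  have hc : ⇑(dilEquiv n hε) = dil ε := coe_dilL ε
  simp only [preimage_univ, iteratedFDerivWithin_univ] at key
  rw [hc, dil_axisPt] at key
  have : (fun p => f (dil ε p)) = f ∘ dil ε := rfl
  rw [this, key, ContinuousMultilinearMap.compContinuousLinearMap_apply]
  have h2 : (fun i => (↑(dilEquiv n hε) : Coord n →L[ℝ] Coord n) (w i)) =
      fun i => ε ^ d i • w i := by
    funext i
    rw [← (hw i).dil_eq ε, ← hc]
    rfl
  rw [h2, ContinuousMultilinearMap.map_smul_univ, Finset.prod_pow_eq_pow_sum]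

/-- A function which after dilation is smoothly `o(ε ^ r)` has weighted order at least `r + 1`. -/
theorem weightedOrder_of_smoothConv {J : Set ℝ} {f : Coord n → A} {r : ℕ}
    (hf : ∀ u ∈ J, ContDiffAt ℝ ∞ f (axisPt n u))
    (h : SmoothConv (fun ε p => (ε ^ r)⁻¹ • f (dil ε p)) (fun _ => 0) (slab n J)) :
    WeightedOrder J (r + 1) f := by
  intro u hu m w d hw hd
  have h1 := (h {axisPt n u} (singleton_subset_iff.2 hu) isCompact_singleton m).tendsto_at
    (mem_singleton _)
  have h2 := ((ContinuousMultilinearMap.apply ℝ (fun _ : Fin m => Coord n) A w).continuous.tendsto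
    _).comp h1
  -- In the directions `w`, the derivative of `ε⁻ʳ f ∘ δ_ε` at the axis is `ε ^ (∑ d - r)` times
  -- that of `f`. Multiplication by `ε ^ (r - ∑ d)`, which stays bounded because `∑ d ≤ r`, leaves a
  -- constant whose limit is `0`.
  have h3 : Tendsto (fun ε : ℝ => ε ^ (r - ∑ i, d i)) (𝓝[>] 0) (𝓝 (0 ^ (r - ∑ i, d i))) :=
    ((continuous_pow _).tendsto 0).mono_left nhdsWithin_le_nhds
  have h4 := h3.smul h2
  have hz : iteratedFDeriv ℝ m (fun _ : Coord n => (0 : A)) (axisPt n u) = 0 := by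
    have := iteratedFDeriv_fun_zero (𝕜 := ℝ) (E := Coord n) (F := A) (n := m)
    exact congrFun this _
  rw [hz, map_zero, smul_zero] at h4
  refine tendsto_nhds_unique (tendsto_const_nhds.congr' ?_) h4
  filter_upwards [self_mem_nhdsWithin] with ε hε
  have hε : (0 : ℝ) < ε := hε
  have hfd : ContDiffAt ℝ ∞ (fun p => f (dil ε p)) (axisPt n u) := by
    have : ContDiffAt ℝ ∞ f (dil ε (axisPt n u)) := by rw [dil_axisPt]; exact hf u hu
    exact this.comp (axisPt n u) ((coe_dilL (n := n) ε) ▸ (dilL n ε).contDiff.contDiffAt)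
  simp only [Function.comp_apply, ContinuousMultilinearMap.apply_apply]
  rw [iteratedFDeriv_const_smul_apply' (hfd.of_le (by exact_mod_cast le_top)),
    smul_apply, iteratedFDeriv_comp_dil hε.ne' f u hw, smul_smul, smul_smul]
  have : ε ^ (r - ∑ i, d i) * ((ε ^ r)⁻¹ * ε ^ ∑ i, d i) = 1 := by
    have hr : ε ^ r = ε ^ (r - ∑ i, d i) * ε ^ ∑ i, d i := by
      rw [← pow_add]; congr 1; omega
    have := pow_pos hε (r - ∑ i, d i)
    have := pow_pos hε (∑ i, d i)
    rw [hr]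
    field_simp
  rw [mul_assoc] at *
  rw [this, one_smul]

end Dilation

/-! ### Pullbacks of Lorentzian metrics -/

section Pullback

variable {E : Type*} [NormedAddCommGroup E] [NormedSpace ℝ E]
  {M : Type*} [TopologicalSpace M] [ChartedSpace E M] [IsManifold 𝓘(ℝ, E) ∞ M]
  {F : Type*} [NormedAddCommGroup F] [NormedSpace ℝ F]
  {F' : Type*} [NormedAddCommGroup F'] [NormedSpace ℝ F']

theorem tangentMapAt_congr {f f' : F → M} {p : F} (h : f =ᶠ[𝓝 p] f') :
    tangentMapAt (E := E) f p = tangentMapAt f' p :=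
  congrArg (fun L : F →L[ℝ] E => L) h.mfderiv_eq

theorem tangentMapAt_comp {f : F' → M} {ψ : F → F'} {p : F}
    (hf : MDifferentiableAt 𝓘(ℝ, F') 𝓘(ℝ, E) f (ψ p)) (hψ : DifferentiableAt ℝ ψ p) :
    tangentMapAt (E := E) (f ∘ ψ) p = (tangentMapAt f (ψ p)).comp (fderiv ℝ ψ p) := by
  unfold tangentMapAt
  rw [mfderiv_comp p hf hψ.mdifferentiableAt, mfderiv_eq_fderiv]
  rfl

theorem LorentzMetric.pullback_comp (g : LorentzMetric E M) {f : F' → M} {ψ : F → F'} {p : F}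
    (hf : MDifferentiableAt 𝓘(ℝ, F') 𝓘(ℝ, E) f (ψ p)) (hψ : DifferentiableAt ℝ ψ p) :
    g.pullback (f ∘ ψ) p =
      (g.pullback f (ψ p)).bilinearComp (fderiv ℝ ψ p) (fderiv ℝ ψ p) := by
  unfold LorentzMetric.pullback
  rw [tangentMapAt_comp hf hψ]
  rfl

theorem LorentzMetric.pullback_congr (g : LorentzMetric E M) {f f' : F → M} {p : F}
    (h : f =ᶠ[𝓝 p] f') : g.pullback f p = g.pullback f' p := by
  unfold LorentzMetric.pullback
  rw [tangentMapAt_congr h, h.eq_of_nhds]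

theorem LorentzMetric.contDiffOn_pullback [FiniteDimensional ℝ F] (g : LorentzMetric E M)
    {f : F → M} {s : Set F} (hs : IsOpen s) (hf : ContMDiffOn 𝓘(ℝ, F) 𝓘(ℝ, E) ∞ f s) :
    ContDiffOn ℝ ∞ (g.pullback f) s := by
  have hT : ∀ a : F, ContMDiffOn 𝓘(ℝ, F) (𝓘(ℝ, E).prod 𝓘(ℝ, E)) ∞
      (fun p => Bundle.TotalSpace.mk' E (E := fun x : M => TangentSpace 𝓘(ℝ, E) x)
        (f p) (mfderiv 𝓘(ℝ, F) 𝓘(ℝ, E) f p a)) s := by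
    intro a
    have h1 := hf.contMDiffOn_tangentMapWithin (m := ∞) (by simp) hs.uniqueMDiffOn
    have h2 : ContMDiffOn 𝓘(ℝ, F) (𝓘(ℝ, F).prod 𝓘(ℝ, F)) ∞
        (fun p : F => (⟨p, a⟩ : TangentBundle 𝓘(ℝ, F) F)) s :=
      contMDiffOn_vectorSpace_iff_contDiffOn.2 contDiffOn_const
    have h3 := h1.comp h2 (fun p hp => hp)
    refine h3.congr fun p hp => ?_
    simp only [Function.comp_apply, tangentMapWithin, mfderivWithin_of_isOpen hs hp]
  refine contDiffOn_clm_apply.2 fun a => contDiffOn_clm_apply.2 fun b => ?_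
  have key : ContMDiffOn 𝓘(ℝ, F) (𝓘(ℝ, E).prod 𝓘(ℝ, ℝ)) ∞
      (fun p => Bundle.TotalSpace.mk' ℝ (E := Bundle.Trivial M ℝ) (f p)
        (g.toFun (f p) (mfderiv 𝓘(ℝ, F) 𝓘(ℝ, E) f p a) (mfderiv 𝓘(ℝ, F) 𝓘(ℝ, E) f p b))) s := by
    apply ContMDiffOn.clm_bundle_apply₂ (F₁ := E) (F₂ := E)
    · exact g.smooth.comp_contMDiffOn hf
    · exact hT a
    · exact hT b
  intro p hp
  have := key p hp
  rw [Bundle.contMDiffWithinAt_totalSpace] at this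
  exact this.2.contDiffWithinAt

theorem LorentzMetric.pullback_symm (g : LorentzMetric E M) (f : F → M) (p a b : F) :
    g.pullback f p a b = g.pullback f p b a :=
  g.symm _ _ _

/-- Subtracting a multiple of `k` makes `w` orthogonal to the timelike vector `t`, where the metric
is positive. Since `k` is null and orthogonal to `w`, this does not change `g(w, w)`. -/
theorem LorentzMetric.pos_of_orthogonal_null (g : LorentzMetric E M) (x : M)
    {k w : TangentSpace 𝓘(ℝ, E) x} (hk : g.toFun x k k = 0) (hk0 : k ≠ 0)
    (hkw : g.toFun x k w = 0) (hw : ∀ c : ℝ, w ≠ c • k) : 0 < g.toFun x w w := by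
  obtain ⟨t, -, ht⟩ := g.signature x
  have htk : g.toFun x t k ≠ 0 := fun h => (ht k h hk0).ne' hk
  have h1 := ht (w - (g.toFun x t w / g.toFun x t k) • k)
    (by rw [map_sub, map_smul, smul_eq_mul, div_mul_cancel₀ _ htk, sub_self])
    (sub_ne_zero.2 (hw _))
  have hwk : g.toFun x w k = 0 := by rw [g.symm, hkw]
  simpa [hk, hkw, hwk] using h1

end Pullback

/-! ### Smooth coordinate systems and their transition maps -/

section OpenPartialHomeomorph

variable {n : ℕ} {E : Type*} [NormedAddCommGroup E] [NormedSpace ℝ E]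
  {M : Type*} [TopologicalSpace M] [ChartedSpace E M] [IsManifold 𝓘(ℝ, E) ∞ M]
  {f : OpenPartialHomeomorph (Coord n) M}

namespace SmoothBothWays

theorem mdifferentiableAt (hf : SmoothBothWays (E := E) f) {p : Coord n} (hp : p ∈ f.source) :
    MDifferentiableAt 𝓘(ℝ, Coord n) 𝓘(ℝ, E) f p :=
  (hf.1.contMDiffAt (f.open_source.mem_nhds hp)).mdifferentiableAt (by simp)

theorem mdifferentiableAt_symm (hf : SmoothBothWays (E := E) f) {x : M} (hx : x ∈ f.target) :
    MDifferentiableAt 𝓘(ℝ, E) 𝓘(ℝ, Coord n) f.symm x :=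
  (hf.2.contMDiffAt (f.open_target.mem_nhds hx)).mdifferentiableAt (by simp)

theorem symm_comp_tangentMapAt (hf : SmoothBothWays (E := E) f) {p : Coord n}
    (hp : p ∈ f.source) (a : Coord n) :
    mfderiv 𝓘(ℝ, E) 𝓘(ℝ, Coord n) f.symm (f p) (tangentMapAt (E := E) f p a) = a := by
  have h1 := mfderiv_comp p (hf.mdifferentiableAt_symm (f.map_source hp)) (hf.mdifferentiableAt hp)
  have h2 : (f.symm ∘ f) =ᶠ[𝓝 p] id := by
    filter_upwards [f.open_source.mem_nhds hp] with q hq using f.left_inv hq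
  rw [h2.mfderiv_eq, mfderiv_id] at h1
  exact (congrArg (fun L : Coord n →L[ℝ] Coord n => L a) h1).symm

theorem tangentMapAt_injective (hf : SmoothBothWays (E := E) f) {p : Coord n}
    (hp : p ∈ f.source) : Function.Injective (tangentMapAt (E := E) f p) := by
  intro a b hab
  rw [← hf.symm_comp_tangentMapAt hp a, hab, hf.symm_comp_tangentMapAt hp b]

/-- The transition map of two charts is smooth. -/
theorem contDiffOn_transition {f' : OpenPartialHomeomorph (Coord n) M}
    (hf : SmoothBothWays (E := E) f) (hf' : SmoothBothWays (E := E) f') :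
    ContDiffOn ℝ ∞ (fun p => f'.symm (f p)) (f.trans f'.symm).source := by
  rw [← contMDiffOn_iff_contDiffOn]
  refine ContMDiffOn.comp (t := f'.target) hf'.2 (hf.1.mono ?_) ?_
  · intro p hp; exact hp.1
  · intro p hp; exact hp.2

theorem pullback_transition (g : LorentzMetric E M) {f' : OpenPartialHomeomorph (Coord n) M}
    (hf : SmoothBothWays (E := E) f) (hf' : SmoothBothWays (E := E) f') {p : Coord n}
    (hp : p ∈ (f.trans f'.symm).source) :
    g.pullback f p = pullTensor (fun p => f'.symm (f p)) (g.pullback f') p := by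
  have hd : DifferentiableAt ℝ (fun p => f'.symm (f p)) p :=
    ((hf.contDiffOn_transition hf').contDiffAt ((f.trans f'.symm).open_source.mem_nhds hp)
      |>.differentiableAt (by simp))
  have h2 : (f : Coord n → M) =ᶠ[𝓝 p] f' ∘ (fun p => f'.symm (f p)) := by
    filter_upwards [(f.trans f'.symm).open_source.mem_nhds hp] with q hq
    exact (f'.right_inv hq.2).symm
  rw [g.pullback_congr h2, g.pullback_comp (ψ := fun p => f'.symm (f p))
    (hf'.mdifferentiableAt (f'.map_target hp.2)) hd]
  rfl

theorem pullback_pos (hf : SmoothBothWays (E := E) f) (g : LorentzMetric E M) {p : Coord n}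
    (hp : p ∈ f.source) {k w : Coord n} (hk : g.pullback f p k k = 0) (hk0 : k ≠ 0)
    (hkw : g.pullback f p k w = 0) (hw : ∀ c : ℝ, w ≠ c • k) : 0 < g.pullback f p w w := by
  have hinj := hf.tangentMapAt_injective hp
  generalize hL : tangentMapAt (E := E) f p = L at hinj
  simp only [LorentzMetric.pullback, hL] at hk hkw ⊢
  refine g.pos_of_orthogonal_null (f p) (k := L k) (w := L w) hk ?_ hkw ?_
  · intro h
    exact hk0 (hinj (h.trans (map_zero L).symm))
  · intro c h
    exact hw c (hinj (h.trans (map_smul L c k).symm))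

end SmoothBothWays

end OpenPartialHomeomorph

/-! ### Plane-wave forms -/

section Rosen

variable {n : ℕ}

/-- The projection `(u, x, v) ↦ x`. -/
def xProj (n : ℕ) : Coord n →L[ℝ] EuclideanSpace ℝ (Fin n) :=
  (ContinuousLinearMap.fst ℝ _ ℝ).comp (ContinuousLinearMap.snd ℝ ℝ _)

/-- The projection `(u, x, v) ↦ v`. -/
def vProj (n : ℕ) : Coord n →L[ℝ] ℝ :=
  (ContinuousLinearMap.snd ℝ _ ℝ).comp (ContinuousLinearMap.snd ℝ ℝ _)

/-- The inclusion `x ↦ (0, x, 0)`. -/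
def xIncl (n : ℕ) : EuclideanSpace ℝ (Fin n) →L[ℝ] Coord n :=
  (ContinuousLinearMap.inr ℝ ℝ _).comp (ContinuousLinearMap.inl ℝ _ ℝ)

@[simp] theorem xProj_apply (p : Coord n) : xProj n p = p.2.1 := rfl
@[simp] theorem vProj_apply (p : Coord n) : vProj n p = p.2.2 := rfl
@[simp] theorem xIncl_apply (ξ : EuclideanSpace ℝ (Fin n)) : xIncl n ξ = (0, ξ, 0) := rfl

/-- The form `2 du dv + C_{ij}(u) dx^i dx^j`. -/
def rosenForm (C : ℝ → (EuclideanSpace ℝ (Fin n) →L[ℝ] EuclideanSpace ℝ (Fin n) →L[ℝ] ℝ)) :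
    TensorField n := fun p =>
  (ContinuousLinearMap.mul ℝ ℝ).bilinearComp (ContinuousLinearMap.fst ℝ ℝ _) (vProj n) +
    (ContinuousLinearMap.mul ℝ ℝ).bilinearComp (vProj n) (ContinuousLinearMap.fst ℝ ℝ _) +
    (C p.1).bilinearComp (xProj n) (xProj n)

@[simp] theorem rosenForm_apply
    (C : ℝ → (EuclideanSpace ℝ (Fin n) →L[ℝ] EuclideanSpace ℝ (Fin n) →L[ℝ] ℝ))
    (p a b : Coord n) :
    rosenForm C p a b = a.1 * b.2.2 + a.2.2 * b.1 + C p.1 a.2.1 b.2.1 := rfl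

theorem pullTensor_apply (f : Coord n → Coord n) (q : TensorField n) (p a b : Coord n) :
    pullTensor f q p a b = q (f p) (fderiv ℝ f p a) (fderiv ℝ f p b) := rfl

theorem fderiv_dil (ε : ℝ) (p : Coord n) : fderiv ℝ (dil ε) p = dilL n ε := by
  rw [← coe_dilL]
  exact (dilL n ε).fderiv

theorem contDiffOn_clm_apply₂ {F : Type*} [NormedAddCommGroup F] [NormedSpace ℝ F]
    {f : F → Coord n →L[ℝ] Coord n →L[ℝ] ℝ} {s : Set F} :
    ContDiffOn ℝ ∞ f s ↔ ∀ a b, ContDiffOn ℝ ∞ (fun z => f z a b) s := by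
  rw [contDiffOn_clm_apply]
  exact forall_congr' fun a => contDiffOn_clm_apply

namespace IsRosen

variable {J : Set ℝ} {q : TensorField n}

theorem contDiffOn (h : IsRosen J q) : ContDiffOn ℝ ∞ q (slab n J) := by
  obtain ⟨C, h1, -, h3⟩ := h
  have hC : ContDiffOn ℝ ∞ (fun p : Coord n => C p.1) (slab n J) :=
    h1.comp contDiffOn_fst (fun p hp => hp)
  refine contDiffOn_clm_apply₂.2 fun a b => ?_
  refine ContDiffOn.congr ?_ fun p hp => h3 p hp a b
  exact contDiffOn_const.add ((hC.clm_apply contDiffOn_const).clm_apply contDiffOn_const)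

theorem congr (h : IsRosen J q) {q' : TensorField n} (he : EqOn q q' (slab n J)) :
    IsRosen J q' := by
  obtain ⟨C, h1, h2, h3⟩ := h
  exact ⟨C, h1, h2, fun p hp a b => by rw [← he hp, h3 p hp a b]⟩

theorem symm (h : IsRosen J q) {p : Coord n} (hp : p ∈ slab n J) (a b : Coord n) :
    q p a b = q p b a := by
  obtain ⟨C, -, h2, h3⟩ := h
  rw [h3 p hp, h3 p hp, (h2 p.1 hp).1 a.2.1]
  ring

/-- Plane-wave forms scale with weight `2` under dilations. -/
theorem apply_dil (h : IsRosen J q) {p : Coord n} (hp : p ∈ slab n J) (ε : ℝ) (a b : Coord n) :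
    q (dil ε p) (dil ε a) (dil ε b) = ε ^ 2 * q p a b := by
  obtain ⟨C, -, -, h3⟩ := h
  rw [h3 p hp, h3 (dil ε p) hp]
  simp only [dil, map_smul, smul_apply, smul_eq_mul]
  ring

/-- Plane-wave forms are Lorentzian. -/
theorem signature (h : IsRosen J q) {p : Coord n} (hp : p ∈ slab n J) :
    ∃ t : Coord n, q p t t < 0 ∧ ∀ w : Coord n, q p t w = 0 → w ≠ 0 → 0 < q p w w := by
  obtain ⟨C, -, h2, h3⟩ := h
  refine ⟨(1, 0, -1), ?_, fun w hw hw0 => ?_⟩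
  · rw [h3 p hp]; simp
  · rw [h3 p hp] at hw ⊢
    have hwv : w.2.2 = w.1 := by simp at hw; linarith
    rw [hwv]
    by_cases hx : w.2.1 = 0
    · have hu : w.1 ≠ 0 := by
        intro hu
        apply hw0
        rw [← Prod.mk.eta (p := w), ← Prod.mk.eta (p := w.2), hwv, hu, hx]
        rfl
      rw [hx]
      simp only [map_zero, add_zero]
      linarith [mul_self_pos.2 hu]
    · have := (h2 p.1 hp).2 _ hx
      nlinarith [mul_self_nonneg w.1]

end IsRosen

end Rosen

/-! ### The limit of the rescaled metrics -/

section Limit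

variable {n : ℕ} {M : Type u} [TopologicalSpace M]
  [ChartedSpace (EuclideanSpace ℝ (Fin (n + 2))) M]
  [IsManifold 𝓘(ℝ, EuclideanSpace ℝ (Fin (n + 2))) ∞ M]
  {g : LorentzMetric (EuclideanSpace ℝ (Fin (n + 2))) M} {γ : ℝ → M} {I : Set ℝ}
  {η : ContactScaleJet g γ I}

namespace AdaptedChart

theorem contDiffOn_pullback (Φ : AdaptedChart η) :
    ContDiffOn ℝ ∞ (g.pullback Φ.chart) Φ.chart.source :=
  g.contDiffOn_pullback Φ.chart.open_source Φ.smooth.1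

/-- The coefficients `C_{ij}(u)` of `Φ^* g` along the axis. -/
def screenMetric (Φ : AdaptedChart η) (u : ℝ) :
    EuclideanSpace ℝ (Fin n) →L[ℝ] EuclideanSpace ℝ (Fin n) →L[ℝ] ℝ :=
  (g.pullback Φ.chart (axisPt n u)).bilinearComp (xIncl n) (xIncl n)

@[simp] theorem screenMetric_apply (Φ : AdaptedChart η) (u : ℝ) (ξ ζ : EuclideanSpace ℝ (Fin n)) :
    Φ.screenMetric u ξ ζ = g.pullback Φ.chart (axisPt n u) (0, ξ, 0) (0, ζ, 0) := rfl

/-- The plane-wave metric `2 du dv + C_{ij}(u) dx^i dx^j` of an adapted chart. -/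
def planeWave (Φ : AdaptedChart η) : TensorField n := rosenForm Φ.screenMetric

theorem contDiffOn_screenMetric (Φ : AdaptedChart η) : ContDiffOn ℝ ∞ Φ.screenMetric Φ.axis := by
  have h1 : ContDiffOn ℝ ∞ (fun u => g.pullback Φ.chart (axisPt n u)) Φ.axis :=
    Φ.contDiffOn_pullback.comp (by unfold axisPt; fun_prop) Φ.axis_mem
  exact contDiffOn_clm_apply.2 fun ξ => contDiffOn_clm_apply.2 fun ζ =>
    (h1.clm_apply contDiffOn_const).clm_apply contDiffOn_const

/-- Positivity of `C` comes from `pullback_pos`: `(0, ξ, 0)` is orthogonal to the null vector `∂_u`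
and is not a multiple of it. -/
theorem isRosen_planeWave (Φ : AdaptedChart η) : IsRosen Φ.axis Φ.planeWave := by
  refine ⟨Φ.screenMetric, Φ.contDiffOn_screenMetric, fun u hu => ⟨fun ξ ζ => ?_, fun ξ hξ => ?_⟩,
    fun p _ a b => rfl⟩
  · rw [screenMetric_apply, screenMetric_apply, g.pullback_symm]
  · have hs := Φ.axis_mem u hu
    refine Φ.smooth.pullback_pos g hs (k := (1, 0, 0)) (w := (0, ξ, 0)) (Φ.metric_uu _ hs) ?_
      (Φ.metric_ux _ hs ξ) ?_
    · intro h
      simpa using congrArg Prod.fst h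
    · intro c h
      exact hξ (by simpa using congrArg (fun w : Coord n => w.2.1) h)

theorem rescaled_apply (Φ : AdaptedChart η) (ε : ℝ) (p a b : Coord n) :
    Φ.rescaled ε p a b =
      (ε ^ 2)⁻¹ * g.pullback Φ.chart (dil ε p) (dil ε a) (dil ε b) := by
  simp only [rescaled, smul_apply, smul_eq_mul, pullTensor_apply, fderiv_dil,
    coe_dilL]

/-- With `δ_ε a = a_u ∂_u + ε L_ε a`, the components `g(∂_u, ∂_u) = 0` and `g(∂_u, L_ε a) = ε a_v`
absorb the singular factor `ε⁻²`. What remains is the constant form `2 du dv` plus `g(L_ε ·, L_ε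
·)`, which needs no division by `ε`. -/
theorem extendsSmoothly_rescaled (Φ : AdaptedChart η) :
    ExtendsSmoothly Φ.rescaled Φ.planeWave (slab n Φ.axis) := by
  let S := g.pullback Φ.chart
  let L : ℝ → Coord n →L[ℝ] Coord n := fun ε =>
    (xIncl n).comp (xProj n) +
      ε • ((ContinuousLinearMap.inr ℝ ℝ _).comp (ContinuousLinearMap.inr ℝ _ ℝ)).comp (vProj n)
  have hL : ∀ ε (a : Coord n), L ε a = (0, a.2.1, ε * a.2.2) := by
    intro ε a; simp [L]
  refine ⟨(fun z : ℝ × Coord n => dil z.1 z.2) ⁻¹' Φ.chart.source,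
    fun z => rosenForm 0 z.2 + (S (dil z.1 z.2)).bilinearComp (L z.1) (L z.1),
    Φ.chart.open_source.preimage contDiff_dil.continuous, ?_, ?_, ?_⟩
  · have hS : ContDiffOn ℝ ∞ (fun z : ℝ × Coord n => S (dil z.1 z.2))
        ((fun z : ℝ × Coord n => dil z.1 z.2) ⁻¹' Φ.chart.source) :=
      Φ.contDiffOn_pullback.comp contDiff_dil.contDiffOn (fun z hz => hz)
    refine contDiffOn_clm_apply₂.2 fun a b => ?_
    simp only [add_apply, ContinuousLinearMap.bilinearComp_apply, hL, rosenForm_apply]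
    refine ContDiffOn.add (by simpa using contDiffOn_const) ?_
    exact (hS.clm_apply (by fun_prop)).clm_apply (by fun_prop)
  · intro p hp
    refine ⟨?_, ?_⟩
    · change dil 0 p ∈ Φ.chart.source
      rw [dil_zero]
      exact Φ.axis_mem _ hp
    · refine ContinuousLinearMap.ext fun a => ContinuousLinearMap.ext fun b => ?_
      simp only [add_apply, ContinuousLinearMap.bilinearComp_apply, hL, rosenForm_apply, planeWave,
        dil_zero, zero_mul, screenMetric_apply, S]
      simp
  · rintro ⟨ε, p⟩ hz hε
    have hε : 0 < ε := hε
    have hz : dil ε p ∈ Φ.chart.source := hz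
    refine ContinuousLinearMap.ext fun a => ContinuousLinearMap.ext fun b => ?_
    dsimp only
    rw [rescaled_apply]
    simp only [add_apply, ContinuousLinearMap.bilinearComp_apply, rosenForm_apply]
    have hdec : ∀ a : Coord n, dil ε a = a.1 • ((1 : ℝ), 0, 0) + ε • L ε a := by
      intro a
      rw [hL]
      simp only [dil, Prod.smul_mk, Prod.mk_add_mk, smul_zero, smul_eq_mul, mul_one, mul_zero,
        add_zero, zero_add]
      congr 2
      ring
    have hu : ∀ a : Coord n, S (dil ε p) (1, 0, 0) (L ε a) = ε * a.2.2 := by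
      intro a
      have : L ε a = (0, a.2.1, 0) + (ε * a.2.2) • ((0 : ℝ), 0, 1) := by
        rw [hL]; simp
      rw [this, map_add, map_smul, Φ.metric_ux _ hz, Φ.metric_uv _ hz]
      simp
    have hu' : ∀ a : Coord n, S (dil ε p) (L ε a) (1, 0, 0) = ε * a.2.2 := by
      intro a
      rw [← hu a]
      exact g.pullback_symm _ _ _ _
    have huu : S (dil ε p) (1, 0, 0) (1, 0, 0) = 0 := Φ.metric_uu _ hz
    change (ε ^ 2)⁻¹ * S (dil ε p) (dil ε a) (dil ε b) = _
    rw [hdec a, hdec b]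
    simp only [map_add, map_smul, add_apply, smul_apply, smul_eq_mul, hu, hu', huu]
    have := hε.ne'
    simp only [Pi.zero_apply, zero_apply]
    field_simp
    ring

theorem limitsTo_planeWave (Φ : AdaptedChart η) : Φ.LimitsTo Φ.planeWave :=
  Φ.extendsSmoothly_rescaled.smoothConv (isOpen_slab Φ.axis_isOpen)

/-- Limits are determined only on the open slab; beyond it `q` is unconstrained. -/
theorem limitsTo_iff_eqOn (Φ : AdaptedChart η) {q : TensorField n} :
    Φ.LimitsTo q ↔ EqOn Φ.planeWave q (slab n Φ.axis) :=
  ⟨fun h => Φ.limitsTo_planeWave.eqOn h,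
    fun h => Φ.limitsTo_planeWave.congr_limit (isOpen_slab Φ.axis_isOpen) h⟩

theorem LimitsTo.isRosen {Φ : AdaptedChart η} {q : TensorField n} (h : Φ.LimitsTo q) :
    IsRosen Φ.axis q :=
  Φ.isRosen_planeWave.congr (Φ.limitsTo_iff_eqOn.1 h)

end AdaptedChart

end Limit

/-! ### The weighted leading term of the metric -/

section Leading

variable {n : ℕ} {A B : Type*} [NormedAddCommGroup A] [NormedSpace ℝ A]
  [NormedAddCommGroup B] [NormedSpace ℝ B]

/-- Subtracting the limit and applying a linear map `L` gives the form required by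
`weightedOrder_of_smoothConv`, for components of the metric and of the transition map alike. -/
theorem ExtendsSmoothly.map_sub {F : ℝ → Coord n → A} {F₀ : Coord n → A} {U : Set (Coord n)}
    (hU : IsOpen U) (h : ExtendsSmoothly F F₀ U) (L : A →L[ℝ] B) {F' : ℝ → Coord n → B}
    (hF' : ∀ ε : ℝ, 0 < ε → ∀ p ∈ U, F' ε p = L (F ε p - F₀ p)) :
    ExtendsSmoothly F' (fun _ => 0) U := by
  have h0' := h.contDiffOn
  obtain ⟨Ω, G, hΩ, hG, h0, hF⟩ := h
  refine ⟨Ω ∩ Prod.snd ⁻¹' U, fun z => L (G z - F₀ z.2), hΩ.inter (hU.preimage continuous_snd),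
    ?_, fun p hp => ⟨⟨(h0 p hp).1, hp⟩, ?_⟩, fun z hz hpos => ?_⟩
  · exact L.contDiff.comp_contDiffOn ((hG.mono inter_subset_left).sub
      (h0'.comp contDiffOn_snd fun z hz => hz.2))
  · simp [(h0 p hp).2]
  · rw [hF' _ hpos _ hz.2, hF z hz.1 hpos]

theorem tendsto_clm_apply {ι : Type*} {l : Filter ι} {f : ι → A →L[ℝ] B} {f₀ : A →L[ℝ] B}
    {x : ι → A} {x₀ : A} (hf : Tendsto f l (𝓝 f₀)) (hx : Tendsto x l (𝓝 x₀)) :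
    Tendsto (fun i => f i (x i)) l (𝓝 (f₀ x₀)) :=
  (isBoundedBilinearMap_apply.continuous.tendsto (f₀, x₀)).comp (hf.prodMk_nhds hx)

theorem tendsto_dil (p : Coord n) : Tendsto (fun ε : ℝ => dil ε p) (𝓝[>] 0) (𝓝 (axisPt n p.1)) := by
  have h : Continuous fun ε : ℝ => dil ε p := by unfold dil; fun_prop
  have := (h.tendsto 0).mono_left (nhdsWithin_le_nhds (s := Ioi 0))
  rwa [dil_zero] at this

end Leading

section Transition

variable {n : ℕ} {M : Type u} [TopologicalSpace M]
  [ChartedSpace (EuclideanSpace ℝ (Fin (n + 2))) M]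
  [IsManifold 𝓘(ℝ, EuclideanSpace ℝ (Fin (n + 2))) ∞ M]
  {g : LorentzMetric (EuclideanSpace ℝ (Fin (n + 2))) M} {γ : ℝ → M} {I : Set ℝ}
  {η : ContactScaleJet g γ I}

namespace AdaptedChart

theorem LimitsTo.leadingTerm {Φ : AdaptedChart η} {q : TensorField n} (h : Φ.LimitsTo q) :
    Φ.LeadingTerm q := by
  intro i j a b ha hb
  -- Here the truncated difference `3 - i - j` is `0`, so the condition is vacuous. Otherwise `r = 2
  -- - i - j` and the required order is `r + 1`.
  by_cases hij : 3 ≤ i + j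
  · intro u _ m w d _ hd
    omega
  have hq := h.isRosen
  have hU := isOpen_slab (n := n) Φ.axis_isOpen
  obtain ⟨r, hr⟩ : ∃ r, i + j + r = 2 := ⟨2 - i - j, by omega⟩
  have hr3 : 3 - i - j = r + 1 := by omega
  rw [hr3]
  refine weightedOrder_of_smoothConv ?_ ?_
  · intro u hu
    have h1 : ContDiffAt ℝ ∞ (g.pullback Φ.chart) (axisPt n u) :=
      Φ.contDiffOn_pullback.contDiffAt (Φ.chart.open_source.mem_nhds (Φ.axis_mem u hu))
    have h2 : ContDiffAt ℝ ∞ q (axisPt n u) :=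
      hq.contDiffOn.contDiffAt (hU.mem_nhds (axisPt_mem_slab.2 hu))
    exact ((h1.sub h2).clm_apply contDiffAt_const).clm_apply contDiffAt_const
  · refine ExtendsSmoothly.smoothConv hU ?_
    refine Φ.extendsSmoothly_rescaled.map_sub hU
      ((ContinuousLinearMap.apply ℝ ℝ b).comp (ContinuousLinearMap.apply ℝ (Coord n →L[ℝ] ℝ) a)) ?_
    intro ε hε p hp
    -- The homogeneity of `q` lets its value at `p` be rewritten through its value at `δ_ε p`, so
    -- that the rescaled metric minus its limit becomes `ε⁻ʳ` times the component of `Φ^* g - q` at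
    -- `δ_ε p`.
    have hq1 := hq.apply_dil hp ε a b
    rw [← Φ.limitsTo_iff_eqOn.1 h hp] at hq1
    simp only [ContinuousLinearMap.comp_apply, ContinuousLinearMap.apply_apply, sub_apply,
      rescaled_apply, smul_eq_mul]
    rw [ha.dil_eq, hb.dil_eq] at hq1 ⊢
    simp only [map_smul, smul_apply, smul_eq_mul] at hq1 ⊢
    have h2 : ε ^ 2 = ε ^ i * ε ^ j * ε ^ r := by rw [← pow_add, ← pow_add, hr]
    have hi := pow_pos hε i
    have hj := pow_pos hε j
    have hr := pow_pos hε r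
    have hq2 : Φ.planeWave p a b = (ε ^ r)⁻¹ * q (dil ε p) a b := by
      rw [h2] at hq1
      field_simp
      have : ε ^ i * ε ^ j * (ε ^ r * Φ.planeWave p a b) = ε ^ i * ε ^ j * q (dil ε p) a b := by
        linarith
      have := mul_left_cancel₀ (by positivity) this
      linarith
    rw [hq2, h2]
    field_simp

theorem limitsTo_iff_leadingTerm (Φ : AdaptedChart η) {q : TensorField n}
    (hq : IsRosen Φ.axis q) : Φ.LimitsTo q ↔ Φ.LeadingTerm q := by
  refine ⟨fun h => h.leadingTerm, fun h => Φ.limitsTo_iff_eqOn.2 fun p hp => ?_⟩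
  obtain ⟨C, -, -, hC⟩ := hq
  have key : ∀ ξ ζ, Φ.screenMetric p.1 ξ ζ = C p.1 ξ ζ := by
    intro ξ ζ
    -- For the converse the value on the axis suffices: the `dx dx` components have required order
    -- `3 - 1 - 1 = 1`, so their zeroth Taylor coefficient vanishes.
    have := h 1 1 (0, ξ, 0) (0, ζ, 0) ⟨rfl, rfl⟩ ⟨rfl, rfl⟩ p.1 hp 0 Fin.elim0 Fin.elim0
      (fun i => i.elim0) (by simp)
    rw [iteratedFDeriv_zero_apply] at this
    simp only [sub_apply] at this
    rw [hC (axisPt n p.1) hp] at this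
    simp only [axisPt, mul_zero, zero_add, sub_eq_zero] at this
    exact this
  refine ContinuousLinearMap.ext fun a => ContinuousLinearMap.ext fun b => ?_
  rw [hC p hp, planeWave, rosenForm_apply, key]

/-! ### Transition maps of adapted charts and their leading parts -/

theorem isOpen_overlap (Φ Φ' : AdaptedChart η) : IsOpen (overlap Φ Φ') :=
  Φ.axis_isOpen.inter (Φ'.axis_isOpen.preimage (by fun_prop : Continuous fun s : ℝ =>
    s + Φ.shift - Φ'.shift))

theorem overlap_self (Φ : AdaptedChart η) : overlap Φ Φ = Φ.axis := by
  ext s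
  simp [overlap]

theorem chart_axisPt_eq {Φ Φ' : AdaptedChart η} {s : ℝ} (hs : s ∈ overlap Φ Φ') :
    Φ.chart (axisPt n s) = Φ'.chart (axisPt n (s + Φ.shift - Φ'.shift)) := by
  rw [(Φ.axis_param s hs.1).2, (Φ'.axis_param _ hs.2).2]
  congr 2
  ring

theorem chart_axisPt_mem {Φ Φ' : AdaptedChart η} {s : ℝ} (hs : s ∈ overlap Φ Φ') :
    Φ.chart (axisPt n s) ∈ Φ'.chart.target := by
  rw [chart_axisPt_eq hs]
  exact Φ'.chart.map_source (Φ'.axis_mem _ hs.2)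

theorem transition_axisPt {Φ Φ' : AdaptedChart η} {s : ℝ} (hs : s ∈ overlap Φ Φ') :
    transition Φ Φ' (axisPt n s) = axisPt n (s + Φ.shift - Φ'.shift) := by
  rw [transition, chart_axisPt_eq hs]
  exact Φ'.chart.left_inv (Φ'.axis_mem _ hs.2)

/-- The domain of the transition map. -/
def transitionSource (Φ Φ' : AdaptedChart η) : Set (Coord n) :=
  (Φ.chart.trans Φ'.chart.symm).source

theorem isOpen_transitionSource (Φ Φ' : AdaptedChart η) : IsOpen (transitionSource Φ Φ') :=
  (Φ.chart.trans Φ'.chart.symm).open_source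

theorem contDiffOn_transition (Φ Φ' : AdaptedChart η) :
    ContDiffOn ℝ ∞ (transition Φ Φ') (transitionSource Φ Φ') :=
  Φ.smooth.contDiffOn_transition Φ'.smooth

theorem axisPt_mem_transitionSource {Φ Φ' : AdaptedChart η} {s : ℝ} (hs : s ∈ overlap Φ Φ') :
    axisPt n s ∈ transitionSource Φ Φ' :=
  ⟨Φ.axis_mem s hs.1, chart_axisPt_mem hs⟩

theorem differentiableAt_transition {Φ Φ' : AdaptedChart η} {p : Coord n}
    (hp : p ∈ transitionSource Φ Φ') : DifferentiableAt ℝ (transition Φ Φ') p :=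
  ((contDiffOn_transition Φ Φ').contDiffAt
    ((isOpen_transitionSource Φ Φ').mem_nhds hp)).differentiableAt (by simp)

theorem pullback_eq_pullTensor_transition {Φ Φ' : AdaptedChart η} {p : Coord n}
    (hp : p ∈ transitionSource Φ Φ') :
    g.pullback Φ.chart p = pullTensor (transition Φ Φ') (g.pullback Φ'.chart) p :=
  Φ.smooth.pullback_transition g Φ'.smooth hp

/-- This is the identity `g(∂_u, ·) = dv`, through which the metric controls the `v`-component of a
transition map. -/
theorem pullback_u (Φ : AdaptedChart η) {p : Coord n} (hp : p ∈ Φ.chart.source) (w : Coord n) :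
    g.pullback Φ.chart p (1, 0, 0) w = w.2.2 := by
  have : w = w.1 • ((1 : ℝ), 0, 0) + (0, w.2.1, 0) + w.2.2 • ((0 : ℝ), 0, 1) := by simp
  rw [this, map_add, map_add, map_smul, map_smul, Φ.metric_uu _ hp, Φ.metric_ux _ hp,
    Φ.metric_uv _ hp]
  simp

theorem fderiv_transition_u {Φ Φ' : AdaptedChart η} {s : ℝ} (hs : s ∈ overlap Φ Φ') :
    fderiv ℝ (transition Φ Φ') (axisPt n s) (1, 0, 0) = (1, 0, 0) := by
  have h1 : HasDerivAt (fun s : ℝ => axisPt n s) ((1 : ℝ), 0, 0) s :=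
    (hasDerivAt_id s).prodMk (hasDerivAt_const s _)
  have h2 := (differentiableAt_transition (axisPt_mem_transitionSource hs)).hasFDerivAt.comp_hasDerivAt
    s h1
  have h3 : HasDerivAt (fun s : ℝ => axisPt n (s + Φ.shift - Φ'.shift)) ((1 : ℝ), 0, 0) s :=
    (((hasDerivAt_id s).add_const _).sub_const _).prodMk (hasDerivAt_const s _)
  refine h2.unique (h3.congr_of_eventuallyEq ?_)
  filter_upwards [(isOpen_overlap Φ Φ').mem_nhds hs] with t ht using transition_axisPt ht

/-- The `v`-component of the transition map vanishes to second order in `x`. -/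
theorem fderiv_transition_x_v {Φ Φ' : AdaptedChart η} {s : ℝ} (hs : s ∈ overlap Φ Φ')
    (ξ : EuclideanSpace ℝ (Fin n)) :
    (fderiv ℝ (transition Φ Φ') (axisPt n s) (0, ξ, 0)).2.2 = 0 := by
  have h1 := Φ.metric_ux _ (Φ.axis_mem s hs.1) ξ
  rw [pullback_eq_pullTensor_transition (axisPt_mem_transitionSource hs), pullTensor_apply,
    fderiv_transition_u hs, transition_axisPt hs, pullback_u _ (Φ'.axis_mem _ hs.2)] at h1
  exact h1

/-- The curve `ε ↦ δ_ε p` leaves the axis with velocity `(0, x, 0)`, since `v` enters only with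
`ε²`. This identifies the first Hadamard coefficient. -/
theorem fderiv_comp_dil_zero {Φ Φ' : AdaptedChart η} {p : Coord n} (hp : p.1 ∈ overlap Φ Φ')
    {B : Type*} [NormedAddCommGroup B] [NormedSpace ℝ B] (L : Coord n →L[ℝ] B) :
    fderiv ℝ (fun z : ℝ × Coord n => L (transition Φ Φ' (dil z.1 z.2))) (0, p) (1, 0) =
      L (fderiv ℝ (transition Φ Φ') (axisPt n p.1) (0, p.2.1, 0)) := by
  have hd := differentiableAt_transition (axisPt_mem_transitionSource hp)
  rw [← dil_zero] at hd
  have h1 : HasDerivAt (fun ε : ℝ => dil ε p) ((0 : ℝ), p.2.1, 0) 0 := by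
    have a1 : HasDerivAt (fun ε : ℝ => ε • p.2.1) p.2.1 0 := by
      simpa using (hasDerivAt_id (0 : ℝ)).smul_const p.2.1
    have a2 : HasDerivAt (fun ε : ℝ => ε ^ 2 * p.2.2) 0 0 := by
      simpa using (hasDerivAt_pow 2 (0 : ℝ)).mul_const p.2.2
    exact (hasDerivAt_const _ _).prodMk (a1.prodMk a2)
  have h2 : HasDerivAt (fun ε : ℝ => L (transition Φ Φ' (dil ε p)))
      (L (fderiv ℝ (transition Φ Φ') (dil 0 p) (0, p.2.1, 0))) 0 :=
    L.hasFDerivAt.comp_hasDerivAt (0 : ℝ) (HasFDerivAt.comp_hasDerivAt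
      (f := fun ε : ℝ => dil ε p) (0 : ℝ) hd.hasFDerivAt h1)
  have hf : DifferentiableAt ℝ (fun z : ℝ × Coord n => L (transition Φ Φ' (dil z.1 z.2)))
      (0, p) :=
    L.differentiableAt.comp _ (DifferentiableAt.comp ((0 : ℝ), p)
      (f := fun z : ℝ × Coord n => dil z.1 z.2) (g := transition Φ Φ') hd
      (contDiff_dil.contDiffAt.differentiableAt (by simp)))
  have h3 : HasDerivAt (fun ε : ℝ => (ε, p)) ((1 : ℝ), (0 : Coord n)) 0 :=
    (hasDerivAt_id _).prodMk (hasDerivAt_const _ _)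
  have h4 := hf.hasFDerivAt.comp_hasDerivAt (0 : ℝ) h3
  rw [← dil_zero]
  exact h4.unique h2

theorem conjTransition_eq (Φ Φ' : AdaptedChart η) (ε : ℝ) (p : Coord n) :
    conjTransition Φ Φ' ε p = ((transition Φ Φ' (dil ε p)).1,
      ε⁻¹ • (transition Φ Φ' (dil ε p)).2.1, ε⁻¹ ^ 2 * (transition Φ Φ' (dil ε p)).2.2) := rfl

/-- The `x`-part of `ψ ∘ δ_ε` is divisible by `ε` and the `v`-part by `ε²`, with quotients smooth in
`(ε, p)`. The quotients at `ε = 0` are the components of the limit. -/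
theorem exists_extendsSmoothly_conjTransition (Φ Φ' : AdaptedChart η) :
    ∃ ψ₀ : Coord n → Coord n,
      ExtendsSmoothly (conjTransition Φ Φ') ψ₀ (slab n (overlap Φ Φ')) ∧
      ∀ p ∈ slab n (overlap Φ Φ'), (ψ₀ p).1 = p.1 + Φ.shift - Φ'.shift ∧
        (ψ₀ p).2.1 = (fderiv ℝ (transition Φ Φ') (axisPt n p.1) (0, p.2.1, 0)).2.1 := by
  let δ : ℝ × Coord n → Coord n := fun z => dil z.1 z.2
  let Ω : Set (ℝ × Coord n) := δ ⁻¹' transitionSource Φ Φ' ∩ Prod.snd ⁻¹' slab n (overlap Φ Φ')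
  have hΩ : IsOpen Ω := ((isOpen_transitionSource Φ Φ').preimage contDiff_dil.continuous).inter
    ((isOpen_slab (isOpen_overlap Φ Φ')).preimage continuous_snd)
  have hψ : ContDiffOn ℝ ∞ (fun z => transition Φ Φ' (δ z)) Ω :=
    (contDiffOn_transition Φ Φ').comp contDiff_dil.contDiffOn (fun z hz => hz.1)
  have hzero : ∀ p, ((0 : ℝ), p) ∈ Ω →
      transition Φ Φ' (δ (0, p)) = axisPt n (p.1 + Φ.shift - Φ'.shift) := by
    intro p hp
    rw [← transition_axisPt hp.2, ← dil_zero]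
  obtain ⟨X, hX, hX1, hX0⟩ := exists_contDiffOn_eq_smul hΩ
    (f := fun z => xProj n (transition Φ Φ' (δ z))) ((xProj n).contDiff.comp_contDiffOn hψ)
    (fun p hp => by rw [hzero p hp]; rfl)
  obtain ⟨V, hV, hV1, hV0⟩ := exists_contDiffOn_eq_smul hΩ
    (f := fun z => vProj n (transition Φ Φ' (δ z))) ((vProj n).contDiff.comp_contDiffOn hψ)
    (fun p hp => by rw [hzero p hp]; rfl)
  -- The second division by `ε` is possible because `V (0, p)` is the `v`-component of `dψ (0, x,
  -- 0)`, which vanishes by `fderiv_transition_x_v`.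
  obtain ⟨V', hV', hV'1, -⟩ := exists_contDiffOn_eq_smul hΩ hV (fun p hp => by
    rw [hV0 p hp, fderiv_comp_dil_zero hp.2, vProj_apply, fderiv_transition_x_v hp.2])
  have hmem : ∀ p ∈ slab n (overlap Φ Φ'), ((0 : ℝ), p) ∈ Ω := by
    intro p hp
    refine ⟨?_, hp⟩
    change dil 0 p ∈ transitionSource Φ Φ'
    rw [dil_zero]
    exact axisPt_mem_transitionSource hp
  let G : ℝ × Coord n → Coord n := fun z => ((transition Φ Φ' (δ z)).1, X z, V' z)
  refine ⟨fun p => G (0, p), ⟨Ω, G, hΩ, hψ.fst.prodMk (hX.prodMk hV'),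
    fun p hp => ⟨hmem p hp, rfl⟩, ?_⟩, fun p hp => ⟨?_, ?_⟩⟩
  · rintro ⟨ε, p⟩ hz hε
    have hε : ε ≠ 0 := ne_of_gt hε
    have h1 := hX1 _ hz
    have h2 := hV1 _ hz
    have h3 := hV'1 _ hz
    simp only [xProj_apply, vProj_apply, δ] at h1 h2 h3
    dsimp only
    rw [conjTransition_eq, h1, h2, h3, smul_smul, inv_mul_cancel₀ hε, one_smul]
    simp only [G, smul_eq_mul, δ]
    congr 2
    field_simp
  · simp only [G]
    rw [hzero p (hmem p hp)]
    rfl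
  · simp only [G]
    rw [hX0 p (hmem p hp), fderiv_comp_dil_zero hp, xProj_apply]

theorem leadingPart_eq_of_tendsto {Φ Φ' : AdaptedChart η} {p q : Coord n}
    (h : Tendsto (fun ε => conjTransition Φ Φ' ε p) (𝓝[>] 0) (𝓝 q)) :
    leadingPart Φ Φ' p = q :=
  h.limUnder_eq

theorem extendsSmoothly_conjTransition (Φ Φ' : AdaptedChart η) :
    ExtendsSmoothly (conjTransition Φ Φ') (leadingPart Φ Φ') (slab n (overlap Φ Φ')) := by
  obtain ⟨ψ₀, h, -⟩ := exists_extendsSmoothly_conjTransition Φ Φ'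
  have he : ∀ p ∈ slab n (overlap Φ Φ'), leadingPart Φ Φ' p = ψ₀ p := fun p hp =>
    leadingPart_eq_of_tendsto (h.tendsto hp)
  obtain ⟨Ω, G, hΩ, hG, h0, hF⟩ := h
  exact ⟨Ω, G, hΩ, hG, fun p hp => ⟨(h0 p hp).1, by rw [(h0 p hp).2, he p hp]⟩, hF⟩

theorem leadingPart_fst {Φ Φ' : AdaptedChart η} {p : Coord n}
    (hp : p ∈ slab n (overlap Φ Φ')) :
    (leadingPart Φ Φ' p).1 = p.1 + Φ.shift - Φ'.shift := by
  obtain ⟨ψ₀, h, h1⟩ := exists_extendsSmoothly_conjTransition Φ Φ'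
  rw [leadingPart_eq_of_tendsto (h.tendsto hp), (h1 p hp).1]

theorem leadingPart_x {Φ Φ' : AdaptedChart η} {p : Coord n}
    (hp : p ∈ slab n (overlap Φ Φ')) : (leadingPart Φ Φ' p).2.1 =
      (fderiv ℝ (transition Φ Φ') (axisPt n p.1) (0, p.2.1, 0)).2.1 := by
  obtain ⟨ψ₀, h, h1⟩ := exists_extendsSmoothly_conjTransition Φ Φ'
  rw [leadingPart_eq_of_tendsto (h.tendsto hp), (h1 p hp).2]

theorem smoothConv_conjTransition (Φ Φ' : AdaptedChart η) :
    SmoothConv (conjTransition Φ Φ') (leadingPart Φ Φ') (slab n (overlap Φ Φ')) :=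
  (extendsSmoothly_conjTransition Φ Φ').smoothConv (isOpen_slab (isOpen_overlap Φ Φ'))

theorem contDiffOn_leadingPart (Φ Φ' : AdaptedChart η) :
    ContDiffOn ℝ ∞ (leadingPart Φ Φ') (slab n (overlap Φ Φ')) :=
  (extendsSmoothly_conjTransition Φ Φ').contDiffOn

theorem leadingPart_axisPt {Φ Φ' : AdaptedChart η} {s : ℝ} (hs : s ∈ overlap Φ Φ') :
    leadingPart Φ Φ' (axisPt n s) = axisPt n (s + Φ.shift - Φ'.shift) := by
  refine leadingPart_eq_of_tendsto (tendsto_const_nhds.congr fun ε => ?_)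
  rw [conjTransition, dil_axisPt, transition_axisPt hs, dil_axisPt]

theorem eventually_dil_mem_transitionSource {Φ Φ' : AdaptedChart η} {p : Coord n}
    (hp : p ∈ slab n (overlap Φ Φ')) : ∀ᶠ ε in 𝓝[>] (0 : ℝ), dil ε p ∈ transitionSource Φ Φ' :=
  (tendsto_dil p).eventually
    ((isOpen_transitionSource Φ Φ').mem_nhds (axisPt_mem_transitionSource hp))

theorem leadingPart_self {Φ : AdaptedChart η} {p : Coord n} (hp : p ∈ slab n Φ.axis) :
    leadingPart Φ Φ p = p := by
  refine leadingPart_eq_of_tendsto (tendsto_const_nhds.congr' ?_)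
  have hp : p ∈ slab n (overlap Φ Φ) := by rwa [overlap_self]
  filter_upwards [eventually_dil_mem_transitionSource hp, self_mem_nhdsWithin] with ε hε hpos
  rw [conjTransition, transition, Φ.chart.left_inv hε.1, dil_inv_dil (ne_of_gt hpos)]

theorem leadingPart_mem {Φ Φ' : AdaptedChart η} {p : Coord n} (hp : p ∈ slab n (overlap Φ Φ')) :
    leadingPart Φ Φ' p ∈ slab n (overlap Φ' Φ) := by
  refine ⟨?_, ?_⟩
  · rw [leadingPart_fst hp]; exact hp.2
  · rw [leadingPart_fst hp]; simpa using hp.1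

/-- For small `ε` the conjugated transition maps compose exactly, because the inner `δ_ε ∘ δ_ε⁻¹`
cancels. The limit of the composition is taken with a moving point of evaluation. -/
theorem leadingPart_leadingPart {Φ Φ' Φ'' : AdaptedChart η} {p : Coord n}
    (hp : p ∈ slab n (overlap Φ Φ')) (hp' : p ∈ slab n (overlap Φ Φ'')) :
    leadingPart Φ' Φ'' (leadingPart Φ Φ' p) = leadingPart Φ Φ'' p := by
  have hm : leadingPart Φ Φ' p ∈ slab n (overlap Φ' Φ'') := by
    refine ⟨?_, ?_⟩
    · rw [leadingPart_fst hp]; exact hp.2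
    · rw [leadingPart_fst hp]; simpa using hp'.2
  have h1 := (extendsSmoothly_conjTransition Φ' Φ'').tendsto_comp hm
    ((extendsSmoothly_conjTransition Φ Φ').tendsto hp)
  refine (leadingPart_eq_of_tendsto (h1.congr' ?_)).symm
  filter_upwards [eventually_dil_mem_transitionSource hp, self_mem_nhdsWithin] with ε hε hpos
  simp only [conjTransition]
  have h2 : Φ'.chart (Φ'.chart.symm (Φ.chart (dil ε p))) = Φ.chart (dil ε p) :=
    Φ'.chart.right_inv hε.2
  rw [dil_dil_inv (ne_of_gt hpos), transition, transition, h2]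
  rfl

theorem bijOn_leadingPart (Φ Φ' : AdaptedChart η) :
    BijOn (leadingPart Φ Φ') (slab n (overlap Φ Φ')) (slab n (overlap Φ' Φ)) := by
  have key : ∀ Ψ Ψ' : AdaptedChart η,
      LeftInvOn (leadingPart Ψ' Ψ) (leadingPart Ψ Ψ') (slab n (overlap Ψ Ψ')) := by
    intro Ψ Ψ' p hp
    rw [leadingPart_leadingPart hp (by rw [overlap_self]; exact hp.1), leadingPart_self hp.1]
  exact InvOn.bijOn ⟨key Φ Φ', key Φ' Φ⟩ (fun _ h => leadingPart_mem h)
    (fun _ h => leadingPart_mem h)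

/-- Replacing `ε` by `ε c` does not change the limit as `ε → 0⁺`, and `δ_{εc} = δ_ε ∘ δ_c`. -/
theorem leadingPart_dil {Φ Φ' : AdaptedChart η} {c : ℝ} (hc : 0 < c) {p : Coord n}
    (hp : p ∈ slab n (overlap Φ Φ')) :
    leadingPart Φ Φ' (dil c p) = dil c (leadingPart Φ Φ' p) := by
  have h1 : Tendsto (fun ε : ℝ => ε * c) (𝓝[>] 0) (𝓝[>] 0) := by
    refine tendsto_nhdsWithin_iff.2 ⟨?_, ?_⟩
    · have : Tendsto (fun ε : ℝ => ε * c) (𝓝 0) (𝓝 (0 * c)) := (continuous_mul_const c).tendsto 0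
      rw [zero_mul] at this
      exact this.mono_left nhdsWithin_le_nhds
    · filter_upwards [self_mem_nhdsWithin] with ε hε using mul_pos hε hc
  have h2 := ((extendsSmoothly_conjTransition Φ Φ').tendsto hp).comp h1
  have h3 := ((dilL n c).continuous.tendsto _).comp h2
  rw [coe_dilL] at h3
  refine leadingPart_eq_of_tendsto (h3.congr' ?_)
  filter_upwards with ε
  simp only [Function.comp_apply, conjTransition, dil_dil]
  rw [mul_inv, mul_left_comm, mul_inv_cancel₀ hc.ne', mul_one]

theorem fderiv_conjTransition {Φ Φ' : AdaptedChart η} {ε : ℝ} {p : Coord n}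
    (hp : dil ε p ∈ transitionSource Φ Φ') (a : Coord n) :
    fderiv ℝ (conjTransition Φ Φ' ε) p a =
      dil ε⁻¹ (fderiv ℝ (transition Φ Φ') (dil ε p) (dil ε a)) := by
  have h1 : HasFDerivAt (dil ε) (dilL n ε) p := by
    rw [← coe_dilL]; exact (dilL n ε).hasFDerivAt
  have h2 := (differentiableAt_transition hp).hasFDerivAt.comp p h1
  have h3 := (dilL n ε⁻¹).hasFDerivAt.comp p h2
  rw [coe_dilL] at h3
  have h4 : fderiv ℝ (conjTransition Φ Φ' ε) p = _ := h3.fderiv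
  rw [h4]
  simp only [ContinuousLinearMap.comp_apply, coe_dilL]

/-- Already at fixed `ε > 0` the conjugated transition map is an isometry between the rescaled
metrics; the isometry of the limits follows by passing to `ε → 0⁺`. -/
theorem rescaled_eq_of_transition {Φ Φ' : AdaptedChart η} {ε : ℝ} (hε : 0 < ε) {p : Coord n}
    (hp : dil ε p ∈ transitionSource Φ Φ') (a b : Coord n) :
    Φ'.rescaled ε (conjTransition Φ Φ' ε p) (fderiv ℝ (conjTransition Φ Φ' ε) p a)
      (fderiv ℝ (conjTransition Φ Φ' ε) p b) = Φ.rescaled ε p a b := by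
  rw [rescaled_apply, rescaled_apply, fderiv_conjTransition hp, fderiv_conjTransition hp,
    conjTransition, dil_dil_inv hε.ne', dil_dil_inv hε.ne', dil_dil_inv hε.ne',
    pullback_eq_pullTensor_transition hp, pullTensor_apply]

theorem pullTensor_leadingPart_planeWave {Φ Φ' : AdaptedChart η} {p : Coord n}
    (hp : p ∈ slab n (overlap Φ Φ')) :
    pullTensor (leadingPart Φ Φ') Φ'.planeWave p = Φ.planeWave p := by
  refine ContinuousLinearMap.ext fun a => ContinuousLinearMap.ext fun b => ?_
  have h1 := Φ'.extendsSmoothly_rescaled.tendsto_comp (leadingPart_mem hp).1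
    ((extendsSmoothly_conjTransition Φ Φ').tendsto hp)
  -- Pullback involves the differential, so convergence of first derivatives is needed besides that
  -- of values.
  have h2 := (smoothConv_conjTransition Φ Φ').tendsto_fderiv hp
  have h3 : ∀ a : Coord n, Tendsto (fun ε => fderiv ℝ (conjTransition Φ Φ' ε) p a) (𝓝[>] 0)
      (𝓝 (fderiv ℝ (leadingPart Φ Φ') p a)) := fun a => tendsto_clm_apply h2 tendsto_const_nhds
  have h4 := tendsto_clm_apply (tendsto_clm_apply h1 (h3 a)) (h3 b)
  have h5 : Tendsto (fun ε => Φ.rescaled ε p a b) (𝓝[>] 0) (𝓝 (Φ.planeWave p a b)) :=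
    tendsto_clm_apply (tendsto_clm_apply (Φ.extendsSmoothly_rescaled.tendsto hp.1)
      tendsto_const_nhds) tendsto_const_nhds
  refine tendsto_nhds_unique (h4.congr' ?_) h5
  filter_upwards [eventually_dil_mem_transitionSource hp, self_mem_nhdsWithin] with ε hε hpos
  exact rescaled_eq_of_transition hpos hε a b

theorem pullTensor_leadingPart {Φ Φ' : AdaptedChart η} {q q' : TensorField n}
    (hq : Φ.LimitsTo q) (hq' : Φ'.LimitsTo q') {p : Coord n} (hp : p ∈ slab n (overlap Φ Φ')) :
    pullTensor (leadingPart Φ Φ') q' p = q p := by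
  rw [← Φ.limitsTo_iff_eqOn.1 hq hp.1, ← pullTensor_leadingPart_planeWave hp, pullTensor,
    pullTensor, Φ'.limitsTo_iff_eqOn.1 hq' (leadingPart_mem hp).1]

/-! ### Compatibly normalized charts -/

theorem CompatiblyNormalized.fderiv_transition_x {Φ Φ' : AdaptedChart η}
    (h : CompatiblyNormalized Φ Φ') {s : ℝ} (hs : s ∈ overlap Φ Φ')
    (ξ : EuclideanSpace ℝ (Fin n)) :
    (fderiv ℝ (transition Φ Φ') (axisPt n s) (0, ξ, 0)).2.1 = ξ := by
  obtain ⟨r, hr⟩ := h.2 s hs ξ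
  have hsm := axisPt_mem_transitionSource hs
  have hax : transition Φ Φ' (axisPt n s) = axisPt n s := by
    rw [transition_axisPt hs, h.1, add_sub_cancel_right]
  have hs' : axisPt n s ∈ Φ'.chart.source := by
    rw [← hax]
    exact Φ'.chart.map_target hsm.2
  have hT : tangentMapAt (E := EuclideanSpace ℝ (Fin (n + 2))) Φ.chart (axisPt n s) =
      (tangentMapAt Φ'.chart (axisPt n s)).comp (fderiv ℝ (transition Φ Φ') (axisPt n s)) := by
    have h2 : (Φ.chart : Coord n → M) =ᶠ[𝓝 (axisPt n s)] Φ'.chart ∘ transition Φ Φ' := by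
      filter_upwards [(isOpen_transitionSource Φ Φ').mem_nhds hsm] with q hq
      exact (Φ'.chart.right_inv hq.2).symm
    rw [tangentMapAt_congr h2, tangentMapAt_comp (ψ := transition Φ Φ')
      (Φ'.smooth.mdifferentiableAt (by rwa [hax])) (differentiableAt_transition hsm), hax]
  have hinj := Φ'.smooth.tangentMapAt_injective hs'
  rw [hT] at hr
  simp only [ContinuousLinearMap.comp_apply, fderiv_transition_u hs] at hr
  rw [← map_smul, ← map_add] at hr
  rw [hinj hr]
  simp

/-- The `u`- and `x`-components are read off from the first-order data along the axis. The
`v`-component is then fixed by the isometry property and its value on the axis. -/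
theorem CompatiblyNormalized.leadingPart_eq {Φ Φ' : AdaptedChart η}
    (h : CompatiblyNormalized Φ Φ') {p : Coord n} (hp : p ∈ slab n (overlap Φ Φ')) :
    leadingPart Φ Φ' p = p := by
  have hU := isOpen_slab (n := n) (isOpen_overlap Φ Φ')
  have h1 : ∀ p ∈ slab n (overlap Φ Φ'), (leadingPart Φ Φ' p).1 = p.1 := fun p hp => by
    rw [leadingPart_fst hp, h.1, add_sub_cancel_right]
  have h2 : ∀ p ∈ slab n (overlap Φ Φ'), (leadingPart Φ Φ' p).2.1 = p.2.1 := fun p hp => by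
    rw [leadingPart_x hp, h.fderiv_transition_x hp]
  have hd : ∀ p ∈ slab n (overlap Φ Φ'), HasFDerivAt (leadingPart Φ Φ')
      (fderiv ℝ (leadingPart Φ Φ') p) p := fun p hp =>
    (((contDiffOn_leadingPart Φ Φ').contDiffAt (hU.mem_nhds hp)).differentiableAt
      (by simp)).hasFDerivAt
  have hd1 : ∀ p ∈ slab n (overlap Φ Φ'), ∀ b,
      (fderiv ℝ (leadingPart Φ Φ') p b).1 = b.1 := by
    intro p hp b
    have e1 := (hd p hp).fst
    have e2 : HasFDerivAt (fun p => (leadingPart Φ Φ' p).1) (ContinuousLinearMap.fst ℝ ℝ _) p :=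
      hasFDerivAt_fst.congr_of_eventuallyEq (by
        filter_upwards [hU.mem_nhds hp] with q hq using h1 q hq)
    exact congrArg (fun L : Coord n →L[ℝ] ℝ => L b) (e1.unique e2)
  have hd2 : ∀ p ∈ slab n (overlap Φ Φ'), ∀ b,
      (fderiv ℝ (leadingPart Φ Φ') p b).2.1 = b.2.1 := by
    intro p hp b
    have e1 := (hd p hp).snd.fst
    have e2 : HasFDerivAt (fun p => (leadingPart Φ Φ' p).2.1) (xProj n) p :=
      (xProj n).hasFDerivAt.congr_of_eventuallyEq (by
        filter_upwards [hU.mem_nhds hp] with q hq using h2 q hq)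
    exact congrArg (fun L : Coord n →L[ℝ] EuclideanSpace ℝ (Fin n) => L b) (e1.unique e2)
  have hd3 : ∀ p ∈ slab n (overlap Φ Φ'), ∀ b,
      (fderiv ℝ (leadingPart Φ Φ') p b).2.2 = b.2.2 := by
    intro p hp
    -- The isometry property is paired with `∂_u`. Taking `b = ∂_u` gives twice the `v`-component of
    -- `dψ₀ ∂_u`, which is therefore zero, and then general `b` gives `d(v ∘ ψ₀) = dv`.
    have key : ∀ b : Coord n, (fderiv ℝ (leadingPart Φ Φ') p b).2.2 +
        (fderiv ℝ (leadingPart Φ Φ') p (1, 0, 0)).2.2 * b.1 = b.2.2 := by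
      intro b
      have e := congrArg (fun L : Coord n →L[ℝ] Coord n →L[ℝ] ℝ => L (1, 0, 0) b)
        (pullTensor_leadingPart_planeWave hp)
      simp only [pullTensor_apply, planeWave, rosenForm_apply, hd1 p hp, hd2 p hp] at e
      simpa using e
    have k1 := key (1, 0, 0)
    intro b
    have k2 := key b
    have : (fderiv ℝ (leadingPart Φ Φ') p (1, 0, 0)).2.2 = 0 := by simp at k1; linarith
    rw [this] at k2
    linarith
  refine Prod.ext (h1 p hp) (Prod.ext (h2 p hp) ?_)
  -- The curve `c` is the straight segment from the axis point at `t = 0` to `p` at `t = 1`, inside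
  -- the slab. Along it `v ∘ ψ₀ - v` is constant, and it vanishes on the axis.
  let c : ℝ → Coord n := fun t => (p.1, t • p.2)
  have hcm : ∀ t, c t ∈ slab n (overlap Φ Φ') := fun t => hp
  have hc : ∀ t, HasDerivAt c ((0 : ℝ), p.2) t := fun t => by
    have := (hasDerivAt_id t).smul_const p.2
    rw [one_smul] at this
    exact (hasDerivAt_const t p.1).prodMk this
  have hφ : ∀ t, HasDerivAt (fun t => (leadingPart Φ Φ' (c t)).2.2 - t * p.2.2) 0 t := by
    intro t
    have e1 := ((hd _ (hcm t)).comp_hasDerivAt t (hc t))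
    have e2 := (vProj n).hasFDerivAt.comp_hasDerivAt t e1
    rw [vProj_apply, hd3 _ (hcm t)] at e2
    have e3 := e2.sub ((hasDerivAt_id t).mul_const p.2.2)
    rw [one_mul, sub_self] at e3
    exact e3
  have hconst := is_const_of_deriv_eq_zero (fun t => (hφ t).differentiableAt)
    (fun t => (hφ t).deriv) 1 0
  have hc1 : c 1 = p := by simp [c]
  have hc0 : c 0 = axisPt n p.1 := by
    simp only [c, axisPt, zero_smul]
    rfl
  simp only [hc1, hc0, leadingPart_axisPt hp] at hconst
  simp only [axisPt] at hconst
  linarith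

/-- For a projection `L` homogeneous of degree `r`, `L(ψ - id)` at `δ_ε p` is `ε ^ r` times `L` of
the conjugated transition map minus `p`. That difference tends to `0` because `ψ₀ = id`. -/
theorem CompatiblyNormalized.weightedOrder {Φ Φ' : AdaptedChart η}
    (h : CompatiblyNormalized Φ Φ') {B : Type*} [NormedAddCommGroup B] [NormedSpace ℝ B]
    (L : Coord n →L[ℝ] B) {r : ℕ} (hL : ∀ (ε : ℝ) (p : Coord n), L (dil ε p) = ε ^ r • L p) :
    WeightedOrder (overlap Φ Φ') (r + 1) (fun p => L (transition Φ Φ' p) - L p) := by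
  have hU := isOpen_slab (n := n) (isOpen_overlap Φ Φ')
  refine weightedOrder_of_smoothConv ?_ ?_
  · intro u hu
    have := (contDiffOn_transition Φ Φ').contDiffAt
      ((isOpen_transitionSource Φ Φ').mem_nhds (axisPt_mem_transitionSource hu))
    exact (L.contDiff.contDiffAt.comp _ this).sub L.contDiff.contDiffAt
  · refine ExtendsSmoothly.smoothConv hU ?_
    refine (extendsSmoothly_conjTransition Φ Φ').map_sub hU L ?_
    intro ε hε p hp
    rw [h.leadingPart_eq hp, map_sub, conjTransition, hL, hL, smul_sub, smul_smul,
      inv_mul_cancel₀ (pow_ne_zero r hε.ne'), one_smul, inv_pow]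

end AdaptedChart

end Transition

/-! ### Smooth fields of bilinear forms on a manifold -/

section Section

variable {E : Type*} [NormedAddCommGroup E] [NormedSpace ℝ E]
  {M : Type*} [TopologicalSpace M] [ChartedSpace E M] [IsManifold 𝓘(ℝ, E) ∞ M]

/-- A field of bilinear forms is smooth if its coefficients in the preferred charts are. -/
theorem contMDiff_bilinear_section [FiniteDimensional ℝ E]
    (B : ∀ x : M, TangentSpace 𝓘(ℝ, E) x →L[ℝ] TangentSpace 𝓘(ℝ, E) x →L[ℝ] ℝ)
    (h : ∀ (x₀ : M) (a b : E), ContDiffOn ℝ ∞ (fun y =>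
      B ((extChartAt 𝓘(ℝ, E) x₀).symm y) (tangentMapAt (E := E) (extChartAt 𝓘(ℝ, E) x₀).symm y a)
        (tangentMapAt (E := E) (extChartAt 𝓘(ℝ, E) x₀).symm y b)) (extChartAt 𝓘(ℝ, E) x₀).target) :
    ContMDiff 𝓘(ℝ, E) (𝓘(ℝ, E).prod 𝓘(ℝ, E →L[ℝ] E →L[ℝ] ℝ)) ∞
      (fun x => Bundle.TotalSpace.mk' (E →L[ℝ] E →L[ℝ] ℝ) x (B x)) := by
  intro x₀
  rw [contMDiffAt_hom_bundle]
  refine ⟨contMDiffAt_id, ?_⟩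
  let e := extChartAt 𝓘(ℝ, E) x₀
  let φ : E → E →L[ℝ] E →L[ℝ] ℝ := fun y =>
    ContinuousLinearMap.bilinearComp (E := E) (F := E) (G := ℝ) (B (e.symm y))
      (tangentMapAt (E := E) e.symm y) (tangentMapAt (E := E) e.symm y)
  have hφ : ContDiffOn ℝ ∞ φ e.target :=
    contDiffOn_clm_apply.2 fun a => contDiffOn_clm_apply.2 fun b => h x₀ a b
  have h1 : ContMDiffAt 𝓘(ℝ, E) 𝓘(ℝ, E →L[ℝ] E →L[ℝ] ℝ) ∞ (fun x => φ (e x)) x₀ := by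
    have h2 : ContMDiffAt 𝓘(ℝ, E) 𝓘(ℝ, E →L[ℝ] E →L[ℝ] ℝ) ∞ φ (e x₀) :=
      (hφ.contDiffAt (extChartAt_target_mem_nhds x₀)).contMDiffAt
    exact h2.comp x₀ (contMDiffAt_extChartAt (n := ∞))
  refine h1.congr_of_eventuallyEq ?_
  filter_upwards [(chartAt E x₀).open_source.mem_nhds (mem_chart_source E x₀)] with x hx
  refine ContinuousLinearMap.ext fun a => ContinuousLinearMap.ext fun b => ?_
  have hb : x ∈ (trivializationAt E (TangentSpace 𝓘(ℝ, E)) x₀).baseSet := by simpa using hx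
  have hxe : e.symm (e x) = x := e.left_inv (by simpa [e] using hx)
  have hs : ∀ a : E, (trivializationAt E (TangentSpace 𝓘(ℝ, E)) x₀).symm x a =
      tangentMapAt (E := E) e.symm (e x) a := by
    intro a
    have h3 := TangentBundle.symmL_trivializationAt (I := 𝓘(ℝ, E)) hx
    have h4 := congrArg (fun L : E →L[ℝ] E => L a) h3
    simp only [modelWithCornersSelf_coe, range_id, mfderivWithin_univ] at h4
    exact (Bundle.Trivialization.symmL_apply _ hb a).symm.trans h4
  have h5 := inCoordinates_apply_eq₂ (F₁ := E) (F₂ := E) (F₃ := ℝ)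
    (E₁ := fun x : M => TangentSpace 𝓘(ℝ, E) x) (E₂ := fun x : M => TangentSpace 𝓘(ℝ, E) x)
    (E₃ := fun _ : M => ℝ) (x₀ := x₀) (x := x) (ϕ := B x) (v := a) (w := b) hb hb (mem_univ _)
  refine h5.trans ?_
  rw [hs, hs]
  -- The points `e.symm (e x)` and `x` are equal only propositionally, so the form is transported
  -- along that equality as a form on the model space.
  have hB : ∀ z : M, z = x → ∀ a b : E, (B x : E →L[ℝ] E →L[ℝ] ℝ) a b =
      (B z : E →L[ℝ] E →L[ℝ] ℝ) a b := by rintro _ rfl _ _; rfl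
  refine Eq.trans ?_ (hB _ hxe _ _)
  simp

end Section

/-! ### Gluing plane waves -/

/-- Plane-wave metrics `q i` on the slabs over `J i`, with origins `shift i` of the affine parameter,
and a compatible system of isometric transition maps `ψ i j`. -/
structure RosenAtlas (n : ℕ) (κ : Type u) where
  J : κ → Set ℝ
  isOpen_J : ∀ i, IsOpen (J i)
  ordConnected_J : ∀ i, (J i).OrdConnected
  nonempty_J : ∀ i, (J i).Nonempty
  shift : κ → ℝ
  q : κ → TensorField n
  isRosen : ∀ i, IsRosen (J i) (q i)
  ψ : κ → κ → Coord n → Coord n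
  ψ_fst : ∀ i j p, p.1 ∈ J i → p.1 + shift i - shift j ∈ J j →
    (ψ i j p).1 = p.1 + shift i - shift j
  ψ_self : ∀ i p, p.1 ∈ J i → ψ i i p = p
  ψ_ψ : ∀ i j k p, p.1 ∈ J i → p.1 + shift i - shift j ∈ J j → p.1 + shift i - shift k ∈ J k →
    ψ j k (ψ i j p) = ψ i k p
  ψ_axis : ∀ i j s, s ∈ J i → s + shift i - shift j ∈ J j →
    ψ i j (axisPt n s) = axisPt n (s + shift i - shift j)
  contDiffOn_ψ : ∀ i j, ContDiffOn ℝ ∞ (ψ i j)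
    (slab n {s | s ∈ J i ∧ s + shift i - shift j ∈ J j})
  pullTensor_ψ : ∀ i j p, p.1 ∈ J i → p.1 + shift i - shift j ∈ J j →
    pullTensor (ψ i j) (q j) p = q i p

namespace RosenAtlas

variable {n : ℕ} {κ : Type u} (D : RosenAtlas n κ)

/-- The parameters covered by the slabs. -/
def domain : Set ℝ := {s | ∃ i, s - D.shift i ∈ D.J i}

/-- The points of the glued plane wave: a parameter and the remaining coordinates in a slab chosen
for that parameter. -/
@[ext] structure Point : Type u where
  time : ℝ
  pos : EuclideanSpace ℝ (Fin n) × ℝ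
  mem : time ∈ D.domain

variable [hκ : Nonempty κ]

/-- A slab over the parameter `s`. -/
def idx (s : ℝ) : κ := Classical.epsilon fun i => s - D.shift i ∈ D.J i

theorem idx_spec {s : ℝ} (hs : s ∈ D.domain) : s - D.shift (D.idx s) ∈ D.J (D.idx s) :=
  Classical.epsilon_spec hs

theorem add_shift_mem {i : κ} {s : ℝ} (hs : s ∈ D.J i) : s + D.shift i ∈ D.domain :=
  ⟨i, by simpa using hs⟩

instance : Nonempty D.Point :=
  let i : κ := Classical.arbitrary κ
  ⟨⟨(D.nonempty_J i).some + D.shift i, 0, D.add_shift_mem (D.nonempty_J i).some_mem⟩⟩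

variable {D}

/-- The coordinates of a point in the slab chosen for its parameter. -/
def Point.base (x : D.Point) : Coord n := (x.time - D.shift (D.idx x.time), x.pos)

theorem Point.base_mem (x : D.Point) : x.base.1 ∈ D.J (D.idx x.time) := D.idx_spec x.mem

theorem Point.base_add (x : D.Point) (i : κ) :
    x.base.1 + D.shift (D.idx x.time) - D.shift i = x.time - D.shift i := by
  simp [Point.base]

variable (D)

/-- The point with coordinates `p` in the slab `i`. -/
def point (i : κ) (p : Coord n) : D.Point :=
  open scoped Classical in
  if h : p.1 ∈ D.J i then
    -- Transition maps preserve the parameter `time`, so the coordinates in the chosen slab are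
    -- determined by `time` together with `(x, v)`. Each class of identified coordinates thus has
    -- one representative and no quotient is needed.
    ⟨p.1 + D.shift i, (D.ψ i (D.idx (p.1 + D.shift i)) p).2, D.add_shift_mem h⟩
  -- A default value off the slab; `coordEquiv` has the slab as its target and never sees it.
  else Classical.arbitrary _

variable {D} {i j : κ} {p : Coord n}

theorem time_point (hp : p.1 ∈ D.J i) : (D.point i p).time = p.1 + D.shift i := by
  simp [point, hp]

theorem idx_mem (hp : p.1 ∈ D.J i) :
    p.1 + D.shift i - D.shift (D.idx (p.1 + D.shift i)) ∈ D.J (D.idx (p.1 + D.shift i)) :=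
  D.idx_spec (D.add_shift_mem hp)

theorem base_point (hp : p.1 ∈ D.J i) :
    (D.point i p).base = D.ψ i (D.idx (p.1 + D.shift i)) p := by
  refine Prod.ext ?_ ?_
  · rw [D.ψ_fst _ _ _ hp (idx_mem hp), Point.base, time_point hp]
  · simp [Point.base, point, hp]

variable (D)

/-- The coordinates given by the slab `i`. -/
def coordEquiv (i : κ) : PartialEquiv D.Point (Coord n) where
  toFun x := D.ψ (D.idx x.time) i x.base
  invFun := D.point i
  source := {x | x.time - D.shift i ∈ D.J i}
  target := slab n (D.J i)
  map_source' x hx := by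
    change (D.ψ (D.idx x.time) i x.base).1 ∈ D.J i
    rw [D.ψ_fst _ _ _ x.base_mem (by rw [x.base_add]; exact hx), x.base_add]
    exact hx
  map_target' p hp := by
    change (D.point i p).time - D.shift i ∈ D.J i
    rw [time_point hp, add_sub_cancel_right]
    exact hp
  -- Going from the chosen slab to the slab `i` and back is, by the cocycle law, the self-transition
  -- of the chosen slab.
  left_inv' x hx := by
    have h1 := D.ψ_fst _ i _ x.base_mem (by rw [x.base_add]; exact hx)
    rw [x.base_add] at h1
    have h2 : (D.ψ (D.idx x.time) i x.base).1 ∈ D.J i := by rw [h1]; exact hx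
    have h3 : (D.ψ (D.idx x.time) i x.base).1 + D.shift i = x.time := by rw [h1, sub_add_cancel]
    have h4 := base_point h2
    rw [h3, D.ψ_ψ _ _ _ _ x.base_mem (by rw [x.base_add]; exact hx)
      (by rw [x.base_add]; exact D.idx_spec x.mem), D.ψ_self _ _ x.base_mem] at h4
    refine Point.ext ?_ ?_
    · rw [time_point h2, h3]
    · exact congrArg Prod.snd h4
  right_inv' p hp := by
    rw [time_point hp, base_point hp, D.ψ_ψ _ _ _ _ hp (idx_mem hp)
      (by rw [add_sub_cancel_right]; exact hp), D.ψ_self _ _ hp]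

/-- The parameters of the slab `i` which lie in the slab `j`. -/
def overlap (i j : κ) : Set ℝ := {s | s ∈ D.J i ∧ s + D.shift i - D.shift j ∈ D.J j}

theorem isOpen_overlap (i j : κ) : IsOpen (D.overlap i j) :=
  (D.isOpen_J i).inter ((D.isOpen_J j).preimage (by fun_prop : Continuous fun s : ℝ =>
    s + D.shift i - D.shift j))

theorem coordEquiv_trans_source (i j : κ) :
    ((D.coordEquiv i).symm.trans (D.coordEquiv j)).source = slab n (D.overlap i j) := by
  ext p
  rw [PartialEquiv.trans_source]
  refine and_congr_right fun hp => ?_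
  change (D.point i p).time - D.shift j ∈ D.J j ↔ _
  rw [time_point hp]

theorem coordEquiv_point (hp : p ∈ slab n (D.overlap i j)) :
    D.coordEquiv j (D.point i p) = D.ψ i j p := by
  change D.ψ _ _ _ = _
  rw [time_point hp.1, base_point hp.1, D.ψ_ψ _ _ _ _ hp.1 (idx_mem hp.1) hp.2]

/-- The atlas of the glued plane wave. -/
def core : ChartedSpaceCore (Coord n) D.Point where
  atlas := range D.coordEquiv
  chartAt x := D.coordEquiv (D.idx x.time)
  mem_chart_source x := D.idx_spec x.mem
  chart_mem_atlas x := mem_range_self _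
  open_source := by
    rintro _ _ ⟨i, rfl⟩ ⟨j, rfl⟩
    rw [coordEquiv_trans_source]
    exact isOpen_slab (D.isOpen_overlap i j)
  continuousOn_toFun := by
    rintro _ _ ⟨i, rfl⟩ ⟨j, rfl⟩
    rw [coordEquiv_trans_source]
    exact (D.contDiffOn_ψ i j).continuousOn.congr fun p hp => D.coordEquiv_point hp

instance : TopologicalSpace D.Point := D.core.toTopologicalSpace

instance : ChartedSpace (Coord n) D.Point := D.core.toChartedSpace

/-- The coordinates given by the slab `i`, as a chart. -/
def coord (i : κ) : OpenPartialHomeomorph D.Point (Coord n) :=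
  D.core.openPartialHomeomorph (D.coordEquiv i) (mem_range_self i)

/-- The parametrization given by the slab `i`. -/
def ι (i : κ) : OpenPartialHomeomorph (Coord n) D.Point := (D.coord i).symm

theorem coord_source (i : κ) : (D.coord i).source = {x | x.time - D.shift i ∈ D.J i} := rfl

theorem ι_apply (i : κ) (p : Coord n) : D.ι i p = D.point i p := rfl

theorem coord_ι (hp : p ∈ slab n (D.overlap i j)) : D.coord j (D.ι i p) = D.ψ i j p :=
  D.coordEquiv_point hp

theorem chartAt_eq (x : D.Point) : chartAt (Coord n) x = D.coord (D.idx x.time) := rfl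

theorem coord_mem_atlas (i : κ) : D.coord i ∈ atlas (Coord n) D.Point :=
  mem_iUnion₂.2 ⟨D.coordEquiv i, mem_range_self i, rfl⟩

theorem eq_coord_of_mem_atlas {e : OpenPartialHomeomorph D.Point (Coord n)}
    (he : e ∈ atlas (Coord n) D.Point) : ∃ i, e = D.coord i := by
  obtain ⟨_, ⟨i, rfl⟩, h⟩ := mem_iUnion₂.1 he
  exact ⟨i, h⟩

instance : IsManifold 𝓘(ℝ, Coord n) ∞ D.Point := by
  refine isManifold_of_contDiffOn _ _ _ fun e e' he he' => ?_
  obtain ⟨i, rfl⟩ := D.eq_coord_of_mem_atlas he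
  obtain ⟨j, rfl⟩ := D.eq_coord_of_mem_atlas he'
  have hs : ((D.coord i).symm ≫ₕ D.coord j).source = slab n (D.overlap i j) :=
    D.coordEquiv_trans_source i j
  simp only [modelWithCornersSelf_coe, modelWithCornersSelf_coe_symm, Function.id_comp, preimage_id,
    range_id, inter_univ, Function.comp_id, hs]
  exact (D.contDiffOn_ψ i j).congr fun p hp => D.coordEquiv_point hp

theorem smoothBothWays_ι (i : κ) : SmoothBothWays (E := Coord n) (D.ι i) := by
  have h := IsManifold.subset_maximalAtlas (I := 𝓘(ℝ, Coord n)) (n := ∞) (D.coord_mem_atlas i)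
  exact ⟨contMDiffOn_symm_of_mem_maximalAtlas h, contMDiffOn_of_mem_maximalAtlas h⟩

theorem time_eq (x : D.Point) {i : κ} (hx : x ∈ (D.coord i).source) :
    x.time = (D.coord i x).1 + D.shift i := by
  change _ = (D.ψ _ _ _).1 + _
  rw [D.ψ_fst _ _ _ x.base_mem (by rw [x.base_add]; exact hx), x.base_add, sub_add_cancel]

theorem continuous_time : Continuous fun x : D.Point => x.time := by
  refine continuous_iff_continuousAt.2 fun x => ?_
  have hx : x ∈ (D.coord (D.idx x.time)).source := D.idx_spec x.mem
  have hn := (D.coord (D.idx x.time)).open_source.mem_nhds hx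
  have h1 : ContinuousAt (fun y => (D.coord (D.idx x.time) y).1 + D.shift (D.idx x.time)) x :=
    (((D.coord (D.idx x.time)).continuousAt hx).fst).add continuousAt_const
  refine h1.congr ?_
  filter_upwards [hn] with y hy using (D.time_eq y hy).symm

/-- Points with different parameters are separated by the continuous function `time`. Points with
equal parameter lie in a common slab, which is Hausdorff. -/
instance : T2Space D.Point := by
  refine ⟨fun x y hxy => ?_⟩
  by_cases ht : x.time = y.time
  · let e := D.coord (D.idx x.time)
    have hx : x ∈ e.source := D.idx_spec x.mem
    have hy : y ∈ e.source := by
      change y.time - D.shift (D.idx x.time) ∈ D.J (D.idx x.time)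
      rw [← ht]
      exact hx
    obtain ⟨U, V, hU, hV, hxU, hyV, hUV⟩ := t2_separation (e.injOn.ne hx hy hxy)
    exact ⟨_, _, e.isOpen_inter_preimage hU, e.isOpen_inter_preimage hV, ⟨hx, hxU⟩, ⟨hy, hyV⟩,
      (hUV.preimage e).mono inter_subset_right inter_subset_right⟩
  · exact separated_by_continuous D.continuous_time ht

theorem isOpen_shift (i : κ) : IsOpen {s | s - D.shift i ∈ D.J i} :=
  (D.isOpen_J i).preimage (by fun_prop : Continuous fun s : ℝ => s - D.shift i)

theorem domain_eq_iUnion : D.domain = ⋃ i, {s | s - D.shift i ∈ D.J i} := by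
  ext s
  simp [domain]

theorem isOpen_domain : IsOpen D.domain := by
  rw [domain_eq_iUnion]
  exact isOpen_iUnion D.isOpen_shift

/-- There may be uncountably many slabs, but the parameter intervals are open in `ℝ`, so by the
Lindelöf property countably many of them cover the domain. -/
instance : SecondCountableTopology D.Point := by
  obtain ⟨T, hT, hTu⟩ := TopologicalSpace.isOpen_iUnion_countable _ D.isOpen_shift
  have := hT.to_subtype
  have hsc : ∀ i : T, SecondCountableTopology (D.coord i).source := fun i =>
    (D.coord i).secondCountableTopology_source
  refine TopologicalSpace.secondCountableTopology_of_countable_cover (fun i : T => (D.coord i).open_source) ?_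
  refine eq_univ_of_forall fun x => ?_
  have hx := x.mem
  rw [domain_eq_iUnion, ← hTu] at hx
  obtain ⟨i, hi, hxi⟩ := mem_iUnion₂.1 hx
  exact mem_iUnion.2 ⟨⟨i, hi⟩, hxi⟩

/-- The differential of the parametrization by the slab `i`, in the preferred charts. -/
theorem tangentMapAt_ι (hp : p.1 ∈ D.J i) :
    tangentMapAt (E := Coord n) (D.ι i) p = fderiv ℝ (D.ψ i (D.idx (p.1 + D.shift i))) p := by
  have hps : p ∈ slab n (D.overlap i (D.idx (p.1 + D.shift i))) := ⟨hp, idx_mem hp⟩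
  refine ((D.smoothBothWays_ι i).mdifferentiableAt hp).mfderiv.trans ?_
  have hc : chartAt (Coord n) (D.ι i p) = D.coord (D.idx (p.1 + D.shift i)) := by
    rw [chartAt_eq, ι_apply, time_point hp]
  simp only [writtenInExtChartAt, extChartAt, hc, mfld_simps, fderivWithin_univ]
  refine Filter.EventuallyEq.fderiv_eq ?_
  filter_upwards [(isOpen_slab (D.isOpen_overlap _ _)).mem_nhds hps] with y hy
  exact D.coord_ι hy

/-- The metric of the glued plane wave. -/
def form (x : D.Point) :
    TangentSpace 𝓘(ℝ, Coord n) x →L[ℝ] TangentSpace 𝓘(ℝ, Coord n) x →L[ℝ] ℝ :=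
  -- The preferred chart at `x` is the slab `D.idx x.time`, and it identifies the tangent space with
  -- `Coord n`; hence the tensor of that slab can be used directly.
  D.q (D.idx x.time) x.base

/-- The differential of `ι i` in the preferred chart is that of a transition map, so the isometry
condition `pullTensor_ψ` shows that every slab sees its own metric. -/
theorem form_ι (hp : p.1 ∈ D.J i) (a b : Coord n) :
    (D.form (D.ι i p) : Coord n →L[ℝ] Coord n →L[ℝ] ℝ) (tangentMapAt (E := Coord n) (D.ι i) p a)
      (tangentMapAt (E := Coord n) (D.ι i) p b) = D.q i p a b := by
  rw [D.tangentMapAt_ι hp, ← D.pullTensor_ψ i (D.idx (p.1 + D.shift i)) p hp (idx_mem hp),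
    pullTensor_apply]
  change D.q (D.idx (D.point i p).time) (D.point i p).base _ _ = _
  rw [base_point hp, time_point hp]

/-- The metric of the glued plane wave. -/
def metric : LorentzMetric (Coord n) D.Point where
  toFun := D.form
  symm x v w := (D.isRosen _).symm x.base_mem v w
  signature x := (D.isRosen _).signature x.base_mem
  smooth := by
    refine contMDiff_bilinear_section D.form fun x₀ a b => ?_
    have ht : (extChartAt 𝓘(ℝ, Coord n) x₀).target = slab n (D.J (D.idx x₀.time)) := by
      simp only [extChartAt, mfld_simps, chartAt_eq]
      rfl
    have hsymm : ⇑(extChartAt 𝓘(ℝ, Coord n) x₀).symm = D.ι (D.idx x₀.time) := by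
      simp only [extChartAt, mfld_simps, chartAt_eq]
      rfl
    rw [ht, hsymm]
    exact ((contDiffOn_clm_apply₂.1 (D.isRosen (D.idx x₀.time)).contDiffOn a b)).congr
      fun y hy => D.form_ι hy a b

theorem pullback_ι (hp : p.1 ∈ D.J i) : D.metric.pullback (D.ι i) p = D.q i p :=
  ContinuousLinearMap.ext fun a => ContinuousLinearMap.ext fun b => D.form_ι hp a b

theorem isRosen_pullback_ι (i : κ) : IsRosen (D.J i) (D.metric.pullback (D.ι i)) :=
  (D.isRosen i).congr fun _ hp => (D.pullback_ι hp).symm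

theorem ι_eq_ι_iff {p' : Coord n} (hp : p.1 ∈ D.J i) (hp' : p'.1 ∈ D.J j) :
    D.ι i p = D.ι j p' ↔ p.1 + D.shift i = p'.1 + D.shift j ∧ p' = D.ψ i j p := by
  have hov : p.1 + D.shift i = p'.1 + D.shift j → p ∈ slab n (D.overlap i j) := fun h => by
    refine ⟨hp, ?_⟩
    rw [h, add_sub_cancel_right]
    exact hp'
  constructor
  · intro h
    have h1 := congrArg Point.time h
    rw [ι_apply, ι_apply, time_point hp, time_point hp'] at h1
    refine ⟨h1, ?_⟩
    rw [← D.coord_ι (hov h1), h]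
    exact ((D.ι j).left_inv hp').symm
  · rintro ⟨h1, h2⟩
    have hs : D.ι i p ∈ (D.coord j).source := by
      rw [coord_source]
      change (D.point i p).time - D.shift j ∈ D.J j
      rw [time_point hp]
      exact (hov h1).2
    rw [h2, ← D.coord_ι (hov h1)]
    exact ((D.coord j).left_inv hs).symm

end RosenAtlas

/-! ### The glued plane wave as a plane-wave germ -/

section Germ

variable {n : ℕ}

/-- The translation `(u, x, v) ↦ (u - c, x, v)`. -/
def shiftHomeo (n : ℕ) (c : ℝ) : Coord n ≃ₜ Coord n := Homeomorph.addRight (axisPt n (-c))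

theorem shiftHomeo_apply (c : ℝ) (p : Coord n) : shiftHomeo n c p = (p.1 - c, p.2) := by
  simp [shiftHomeo, axisPt, sub_eq_add_neg, Prod.ext_iff]

section Shift

variable {E : Type*} [NormedAddCommGroup E] [NormedSpace ℝ E]
  {M : Type*} [TopologicalSpace M] [ChartedSpace E M] [IsManifold 𝓘(ℝ, E) ∞ M]
  {f : OpenPartialHomeomorph (Coord n) M}

theorem SmoothBothWays.shift (hf : SmoothBothWays (E := E) f) (c : ℝ) :
    SmoothBothWays (E := E) ((shiftHomeo n c).toOpenPartialHomeomorph.trans f) := by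
  have h1 : ContMDiff 𝓘(ℝ, Coord n) 𝓘(ℝ, Coord n) ∞ (shiftHomeo n c) :=
    contMDiff_iff_contDiff.2 (contDiff_id.add contDiff_const)
  have h2 : ContMDiff 𝓘(ℝ, Coord n) 𝓘(ℝ, Coord n) ∞ (shiftHomeo n c).symm := by
    refine contMDiff_iff_contDiff.2 ?_
    have : ⇑(shiftHomeo n c).symm = fun p => p + -axisPt n (-c) := by
      rfl
    rw [this]
    exact contDiff_id.add contDiff_const
  refine ⟨hf.1.comp h1.contMDiffOn (fun p hp => hp.2), ?_⟩
  exact h2.comp_contMDiffOn (hf.2.mono fun x hx => hx.1)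

theorem SmoothBothWays.pullback_shift (g : LorentzMetric E M) (hf : SmoothBothWays (E := E) f)
    (c : ℝ) {p : Coord n} (hp : shiftHomeo n c p ∈ f.source) :
    g.pullback ((shiftHomeo n c).toOpenPartialHomeomorph.trans f) p =
      g.pullback f (shiftHomeo n c p) := by
  have hd : HasFDerivAt (shiftHomeo n c) (ContinuousLinearMap.id ℝ (Coord n)) p :=
    (hasFDerivAt_id p).add_const _
  have h := g.pullback_comp (ψ := shiftHomeo n c) (hf.mdifferentiableAt hp) hd.differentiableAt
  refine h.trans ?_
  rw [hd.fderiv]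
  rfl

end Shift

set_option maxSynthPendingDepth 3 in
/-- The Christoffel symbol `Γ(e, e)` vanishes if the components `g(e, ·)` are constant. -/
theorem LorentzMetric.christoffel_eq_zero {E : Type*} [NormedAddCommGroup E] [NormedSpace ℝ E]
    {M : Type*} [TopologicalSpace M] [ChartedSpace E M] [IsManifold 𝓘(ℝ, E) ∞ M]
    (g : LorentzMetric E M) (x₀ : M) (y : E) (hd : DifferentiableAt ℝ (g.coeff x₀) y) (e : E)
    (ℓ : E →L[ℝ] ℝ) (he : ∀ᶠ z in 𝓝 y, g.coeff x₀ z e = ℓ) : g.christoffel x₀ y e e = 0 := by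
  have h1 : ∀ a, fderiv ℝ (g.coeff x₀) y a e = 0 := by
    intro a
    have h2 : HasFDerivAt (fun z => g.coeff x₀ z e) ((fderiv ℝ (g.coeff x₀) y).flip e) y :=
      ((ContinuousLinearMap.apply ℝ (E →L[ℝ] ℝ) e).hasFDerivAt).comp y hd.hasFDerivAt
    have h3 : HasFDerivAt (fun z => g.coeff x₀ z e) (0 : E →L[ℝ] E →L[ℝ] ℝ) y :=
      (hasFDerivAt_const ℓ y).congr_of_eventuallyEq he
    exact congrArg (fun L : E →L[ℝ] E →L[ℝ] ℝ => L a) (h2.unique h3)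
  have h4 : g.christoffelFirst x₀ y e e = 0 := by
    refine ContinuousLinearMap.ext fun w => ?_
    -- Each of the three terms differentiates a component of `g(e, ·)`, which is constant near `y`.
    change (1 / 2 : ℝ) * (fderiv ℝ (g.coeff x₀) y e e w + fderiv ℝ (g.coeff x₀) y e e w -
      fderiv ℝ (g.coeff x₀) y w e e) = 0
    rw [h1, h1]
    simp
  change (g.coeff x₀ y).inverse (g.christoffelFirst x₀ y e e) = 0
  rw [h4, map_zero]

end Germ

/-! ### The axis of the glued plane wave as a null geodesic -/

namespace RosenAtlas

variable {n : ℕ} {κ : Type u} (D : RosenAtlas n κ) [hκ : Nonempty κ] {i : κ}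

/-- The distinguished null geodesic of the glued plane wave. -/
def Γ (s : ℝ) : D.Point := D.ι (D.idx s) (axisPt n (s - D.shift (D.idx s)))

/-- The axes of the slabs fit together because transition maps translate axis to axis; so the slab
chosen in the definition of `Γ` is immaterial. -/
theorem Γ_eq {s : ℝ} (hs : s - D.shift i ∈ D.J i) : D.Γ s = D.ι i (axisPt n (s - D.shift i)) := by
  have hs' : s ∈ D.domain := ⟨i, hs⟩
  have hi := D.idx_spec hs'
  have h1 : s - D.shift (D.idx s) + D.shift (D.idx s) - D.shift i = s - D.shift i := by ring
  refine (D.ι_eq_ι_iff (p := axisPt n (s - D.shift (D.idx s)))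
    (p' := axisPt n (s - D.shift i)) hi hs).2 ⟨?_, ?_⟩
  · simp [axisPt]
  · rw [D.ψ_axis _ _ _ hi (by rwa [h1]), h1]

theorem ι_axisPt {s : ℝ} (hs : s ∈ D.J i) : D.ι i (axisPt n s) = D.Γ (s + D.shift i) := by
  rw [D.Γ_eq (i := i) (by rwa [add_sub_cancel_right]), add_sub_cancel_right]

theorem time_Γ {s : ℝ} (hs : s ∈ D.domain) : (D.Γ s).time = s := by
  change (D.point _ _).time = s
  rw [time_point (D.idx_spec hs)]
  simp [axisPt]

theorem hasDerivAt_axisPt_sub (c s : ℝ) :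
    HasDerivAt (fun s => axisPt n (s - c)) ((1 : ℝ), 0, 0) s :=
  ((hasDerivAt_id s).sub_const c).prodMk (hasDerivAt_const s _)

theorem Γ_eventuallyEq {s : ℝ} (hs : s - D.shift i ∈ D.J i) :
    D.Γ =ᶠ[𝓝 s] D.ι i ∘ fun s => axisPt n (s - D.shift i) := by
  filter_upwards [(D.isOpen_shift i).mem_nhds hs] with r hr using D.Γ_eq hr

theorem velocity_Γ {s : ℝ} (hs : s - D.shift i ∈ D.J i) :
    (velocity (E := Coord n) D.Γ s : Coord n) =
      tangentMapAt (E := Coord n) (D.ι i) (axisPt n (s - D.shift i)) (1, 0, 0) := by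
  have h1 := tangentMapAt_comp (E := Coord n) (f := D.ι i)
    (ψ := fun s => axisPt n (s - D.shift i)) (p := s)
    ((D.smoothBothWays_ι i).mdifferentiableAt (by exact hs))
    (hasDerivAt_axisPt_sub _ s).differentiableAt
  have h2 : (velocity (E := Coord n) D.Γ s : Coord n) = tangentMapAt (E := Coord n) D.Γ s 1 := rfl
  rw [h2, tangentMapAt_congr (D.Γ_eventuallyEq hs), h1, ContinuousLinearMap.comp_apply,
    fderiv_apply_one_eq_deriv, (hasDerivAt_axisPt_sub _ s).deriv]

theorem form_velocity {s : ℝ} (hs : s ∈ D.domain) :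
    D.metric.toFun (D.Γ s) (velocity D.Γ s) (velocity D.Γ s) = 0 := by
  have hi := D.idx_spec hs
  have h := D.form_ι (p := axisPt n (s - D.shift (D.idx s))) hi (1, 0, 0) (1, 0, 0)
  rw [← D.velocity_Γ hi] at h
  refine h.trans ?_
  obtain ⟨C, -, -, hC⟩ := D.isRosen (D.idx s)
  rw [hC _ hi]
  simp

theorem extChartAt_Γ {s : ℝ} (hs : s ∈ D.domain) :
    ⇑(extChartAt 𝓘(ℝ, Coord n) (D.Γ s)) = (D.ι (D.idx s)).symm := by
  simp only [extChartAt, mfld_simps, chartAt_eq, D.time_Γ hs]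
  rfl

theorem extChartAt_Γ_symm {s : ℝ} (hs : s ∈ D.domain) :
    ⇑(extChartAt 𝓘(ℝ, Coord n) (D.Γ s)).symm = D.ι (D.idx s) := by
  simp only [extChartAt, mfld_simps, chartAt_eq, D.time_Γ hs]
  rfl

theorem coordRep_velocity {s : ℝ} (hs : s ∈ D.domain) :
    coordRep (E := Coord n) D.Γ (velocity D.Γ) s =ᶠ[𝓝 s] fun _ => ((1, 0, 0) : Coord n) := by
  filter_upwards [(D.isOpen_shift (D.idx s)).mem_nhds (D.idx_spec hs)] with r hr
  rw [coordRep, D.extChartAt_Γ hs]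
  have h := (D.smoothBothWays_ι (D.idx s)).symm_comp_tangentMapAt
    (p := axisPt n (r - D.shift (D.idx s))) hr (1, 0, 0)
  rw [← D.velocity_Γ hr, ← D.Γ_eq hr] at h
  exact h

/-- In slab coordinates the velocity is the constant vector `∂_u`, and `g(∂_u, ·) = dv` has constant
components, so `Γ(∂_u, ∂_u) = 0` by `christoffel_eq_zero`. -/
theorem isNullGeodesicOn_Γ : IsNullGeodesicOn D.metric D.Γ D.domain where
  isOpen := D.isOpen_domain
  smooth s hs := by
    have hi := D.idx_spec hs
    have h1 : ContMDiffAt 𝓘(ℝ, Coord n) 𝓘(ℝ, Coord n) ∞ (D.ι (D.idx s))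
        (axisPt n (s - D.shift (D.idx s))) :=
      (D.smoothBothWays_ι _).1.contMDiffAt ((D.ι (D.idx s)).open_source.mem_nhds hi)
    have h2 : ContDiff ℝ ∞ (fun r => axisPt n (r - D.shift (D.idx s))) := by
      unfold axisPt; fun_prop
    exact ((h1.comp s h2.contDiffAt.contMDiffAt).congr_of_eventuallyEq
      (D.Γ_eventuallyEq hi)).contMDiffWithinAt
  velocity_ne_zero s hs h := by
    have h1 := (D.coordRep_velocity hs).eq_of_nhds
    rw [coordRep, h, map_zero] at h1
    exact zero_ne_one (congrArg Prod.fst h1)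
  null s hs := D.form_velocity hs
  geodesic s hs := by
    have hi := D.idx_spec hs
    have h1 := D.coordRep_velocity hs
    have hpt : extChartAt 𝓘(ℝ, Coord n) (D.Γ s) (D.Γ s) = axisPt n (s - D.shift (D.idx s)) := by
      rw [D.extChartAt_Γ hs]
      exact (D.ι (D.idx s)).left_inv hi
    have hU := (isOpen_slab (n := n) (D.isOpen_J (D.idx s))).mem_nhds
      (axisPt_mem_slab.2 hi)
    have hcoeff : D.metric.coeff (D.Γ s) =ᶠ[𝓝 (axisPt n (s - D.shift (D.idx s)))]
        D.q (D.idx s) := by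
      filter_upwards [hU] with y hy
      rw [LorentzMetric.coeff, D.extChartAt_Γ_symm hs, D.pullback_ι hy]
    have hct : connectionTerm D.metric D.Γ (velocity D.Γ) s = 0 := by
      rw [connectionTerm, h1.eq_of_nhds, hpt]
      refine D.metric.christoffel_eq_zero _ _ ?_ _ (vProj n) ?_
      · refine DifferentiableAt.congr_of_eventuallyEq ?_ hcoeff
        exact ((D.isRosen _).contDiffOn.contDiffAt hU).differentiableAt (by simp)
      · obtain ⟨C, -, -, hC⟩ := D.isRosen (D.idx s)
        filter_upwards [hcoeff, hU] with y hy hyU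
        refine ContinuousLinearMap.ext fun w => ?_
        rw [hy, hC _ hyU]
        simp
    unfold HasCovDerivAt
    rw [hct, sub_zero]
    exact (hasDerivAt_const s _).congr_of_eventuallyEq h1

/-- The plane-wave germ obtained by gluing. -/
def germ : PlaneWaveGerm.{u} n where
  carrier := D.Point
  metric := D.metric
  Γ := D.Γ
  domain := D.domain
  nullGeodesic := D.isNullGeodesicOn_Γ
  planeWave s hs := by
    let i := D.idx s
    have hsrc : ∀ p : Coord n, shiftHomeo n (D.shift i) p ∈ (D.ι i).source ↔
        p.1 - D.shift i ∈ D.J i := fun p => by rw [shiftHomeo_apply]; rfl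
    -- The germ's coordinates must use the parameter of `Γ` itself, so the slab is translated by its
    -- shift.
    refine ⟨{r | r - D.shift i ∈ D.J i},
      (shiftHomeo n (D.shift i)).toOpenPartialHomeomorph.trans (D.ι i), D.idx_spec hs,
      fun r hr => ⟨i, hr⟩, D.isOpen_shift i, ?_, ?_, (D.smoothBothWays_ι i).shift _, ?_, ?_⟩
    · exact (D.ordConnected_J i).preimage_mono fun a b hab => sub_le_sub_right hab _
    · ext p
      simp only [OpenPartialHomeomorph.trans_source, Homeomorph.toOpenPartialHomeomorph_source,
        univ_inter]
      exact hsrc p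
    · obtain ⟨C, h1, h2, h3⟩ := D.isRosen i
      refine ⟨fun r => C (r - D.shift i), h1.comp (by fun_prop) fun r hr => hr,
        fun r hr => h2 _ hr, fun p hp a b => ?_⟩
      have hp' := (hsrc p).2 hp
      rw [(D.smoothBothWays_ι i).pullback_shift D.metric _ hp', D.pullback_ι hp',
        h3 _ hp', shiftHomeo_apply]
    · intro r hr
      change D.ι i (shiftHomeo n (D.shift i) (axisPt n r)) = D.Γ r
      rw [D.Γ_eq hr, shiftHomeo_apply]
      rfl

end RosenAtlas

/-! ### Existence of the limiting germ -/

section Existence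

variable {n : ℕ} {M : Type u} [TopologicalSpace M]
  [ChartedSpace (EuclideanSpace ℝ (Fin (n + 2))) M]
  [IsManifold 𝓘(ℝ, EuclideanSpace ℝ (Fin (n + 2))) ∞ M]
  {g : LorentzMetric (EuclideanSpace ℝ (Fin (n + 2))) M} {γ : ℝ → M} {I : Set ℝ}

/-- The plane waves of the adapted charts, glued by the leading parts of the transition maps. -/
def ContactScaleJet.rosenAtlas (η : ContactScaleJet g γ I) : RosenAtlas n (AdaptedChart η) where
  J Φ := Φ.axis
  isOpen_J Φ := Φ.axis_isOpen
  ordConnected_J Φ := Φ.axis_ordConnected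
  nonempty_J Φ := Φ.axis_nonempty
  shift Φ := Φ.shift
  q Φ := Φ.planeWave
  isRosen Φ := Φ.isRosen_planeWave
  ψ := AdaptedChart.leadingPart
  ψ_fst _ _ _ h h' := AdaptedChart.leadingPart_fst ⟨h, h'⟩
  ψ_self _ _ h := AdaptedChart.leadingPart_self h
  ψ_ψ _ _ _ _ h h' h'' := AdaptedChart.leadingPart_leadingPart ⟨h, h'⟩ ⟨h, h''⟩
  ψ_axis _ _ _ h h' := AdaptedChart.leadingPart_axisPt ⟨h, h'⟩
  contDiffOn_ψ := AdaptedChart.contDiffOn_leadingPart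
  pullTensor_ψ _ _ _ h h' := AdaptedChart.pullTensor_leadingPart_planeWave ⟨h, h'⟩

theorem ContactScaleJet.isPenroseLimit_germ (η : ContactScaleJet g γ I)
    [Nonempty (AdaptedChart η)] : IsPenroseLimit η η.rosenAtlas.germ η.rosenAtlas.ι where
  domain_eq := rfl
  source_eq _ := rfl
  smooth := η.rosenAtlas.smoothBothWays_ι
  axis _ _ hs := η.rosenAtlas.ι_axisPt hs
  rosen := η.rosenAtlas.isRosen_pullback_ι
  limit Φ := Φ.limitsTo_iff_eqOn.2 fun _ hp => (η.rosenAtlas.pullback_ι hp).symm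
  leadingTerm Φ := AdaptedChart.LimitsTo.leadingTerm
    (Φ.limitsTo_iff_eqOn.2 fun _ hp => (η.rosenAtlas.pullback_ι hp).symm)
  glue _ _ _ _ hp hp' := η.rosenAtlas.ι_eq_ι_iff hp hp'

/-- Minkowski space, as a plane wave. -/
def flatAtlas (n : ℕ) : RosenAtlas n PUnit.{u + 1} where
  J _ := univ
  isOpen_J _ := isOpen_univ
  ordConnected_J _ := ordConnected_univ
  nonempty_J _ := univ_nonempty
  shift _ := 0
  q _ := rosenForm fun _ => innerSL ℝ
  isRosen _ := ⟨fun _ => innerSL ℝ, contDiffOn_const, fun _ _ =>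
    ⟨fun ξ ζ => real_inner_comm ζ ξ, fun ξ hξ => real_inner_self_pos.2 hξ⟩, fun _ _ _ _ => rfl⟩
  ψ _ _ := id
  ψ_fst _ _ _ _ _ := by simp
  ψ_self _ _ _ := rfl
  ψ_ψ _ _ _ _ _ _ _ := rfl
  ψ_axis _ _ _ _ _ := by simp
  contDiffOn_ψ _ _ := contDiff_id.contDiffOn
  pullTensor_ψ _ _ p _ _ := by
    refine ContinuousLinearMap.ext fun a => ContinuousLinearMap.ext fun b => ?_
    rw [pullTensor_apply, fderiv_id]
    rfl

/-- Minkowski space, with an empty geodesic. -/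
def emptyGerm (n : ℕ) : PlaneWaveGerm.{u} n :=
  { (flatAtlas.{u} n).germ with
    domain := ∅
    nullGeodesic := ⟨isOpen_empty, fun _ h => h.elim, fun _ h => h.elim, fun _ h => h.elim,
      fun _ h => h.elim⟩
    planeWave := fun _ h => h.elim }

/-- With no adapted chart the prescribed domain is empty and every condition on charts is void, but
a manifold is still needed; Minkowski space serves. -/
theorem exists_isPenroseLimit (η : ContactScaleJet g γ I) :
    ∃ (P : PlaneWaveGerm.{u} n) (ι : AdaptedChart η → OpenPartialHomeomorph (Coord n) P.carrier),
      IsPenroseLimit η P ι := by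
  rcases isEmpty_or_nonempty (AdaptedChart η) with h | h
  · refine ⟨emptyGerm n, isEmptyElim, ⟨?_, isEmptyElim, isEmptyElim, isEmptyElim, isEmptyElim,
      isEmptyElim, isEmptyElim, isEmptyElim⟩⟩
    ext s
    simp [emptyGerm]
  · exact ⟨_, _, η.isPenroseLimit_germ⟩

end Existence

/-! ### Uniqueness of the limiting germ -/

section Uniqueness

variable {n : ℕ} {M : Type u} [TopologicalSpace M]
  [ChartedSpace (EuclideanSpace ℝ (Fin (n + 2))) M]
  [IsManifold 𝓘(ℝ, EuclideanSpace ℝ (Fin (n + 2))) ∞ M]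
  {g : LorentzMetric (EuclideanSpace ℝ (Fin (n + 2))) M} {γ : ℝ → M} {I : Set ℝ}
  {η : ContactScaleJet g γ I} {P P' : PlaneWaveGerm.{u} n}
  {ι : AdaptedChart η → OpenPartialHomeomorph (Coord n) P.carrier}
  {ι' : AdaptedChart η → OpenPartialHomeomorph (Coord n) P'.carrier}

/-- The map which identifies the coordinate systems `ι Φ` and `ι' Φ`. -/
def coordMap (ι : AdaptedChart η → OpenPartialHomeomorph (Coord n) P.carrier)
    (ι' : AdaptedChart η → OpenPartialHomeomorph (Coord n) P'.carrier) (x : P.carrier) :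
    P'.carrier :=
  open scoped Classical in
  if h : ∃ z : AdaptedChart η × Coord n, z.2 ∈ slab n z.1.axis ∧ ι z.1 z.2 = x then
    ι' h.choose.1 h.choose.2
  else P'.Γ 0

namespace IsPenroseLimit

/-- The choice in `coordMap` is harmless: the gluing rule is the same for both germs, so two
coordinates naming one point of `P` name one point of `P'`. -/
theorem coordMap_apply (h : IsPenroseLimit η P ι) (h' : IsPenroseLimit η P' ι')
    {Φ : AdaptedChart η} {p : Coord n} (hp : p ∈ slab n Φ.axis) :
    coordMap ι ι' (ι Φ p) = ι' Φ p := by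
  have hex : ∃ z : AdaptedChart η × Coord n, z.2 ∈ slab n z.1.axis ∧ ι z.1 z.2 = ι Φ p :=
    ⟨(Φ, p), hp, rfl⟩
  rw [coordMap, dif_pos hex, h'.glue _ _ _ _ hex.choose_spec.1 hp,
    ← h.glue _ _ _ _ hex.choose_spec.1 hp]
  exact hex.choose_spec.2

theorem symm_mem (h : IsPenroseLimit η P ι) {Φ : AdaptedChart η} {x : P.carrier}
    (hx : x ∈ (ι Φ).target) : (ι Φ).symm x ∈ slab n Φ.axis := by
  rw [← h.source_eq]
  exact (ι Φ).map_target hx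

theorem mem_target (h : IsPenroseLimit η P ι) {Φ : AdaptedChart η} {p : Coord n}
    (hp : p ∈ slab n Φ.axis) : ι Φ p ∈ (ι Φ).target :=
  (ι Φ).map_source (by rwa [h.source_eq])

theorem coordMap_eq (h : IsPenroseLimit η P ι) (h' : IsPenroseLimit η P' ι')
    {Φ : AdaptedChart η} {x : P.carrier} (hx : x ∈ (ι Φ).target) :
    coordMap ι ι' x = ι' Φ ((ι Φ).symm x) := by
  rw [← h.coordMap_apply h' (h.symm_mem hx), (ι Φ).right_inv hx]

theorem contMDiffOn_coordMap (h : IsPenroseLimit η P ι) (h' : IsPenroseLimit η P' ι') :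
    ContMDiffOn 𝓘(ℝ, Coord n) 𝓘(ℝ, Coord n) ∞ (coordMap ι ι') (⋃ Φ, (ι Φ).target) := by
  intro x hx
  obtain ⟨Φ, hΦ⟩ := mem_iUnion.1 hx
  have hn := (ι Φ).open_target.mem_nhds hΦ
  have h1 : ContMDiffAt 𝓘(ℝ, Coord n) 𝓘(ℝ, Coord n) ∞ (ι Φ).symm x :=
    (h.smooth Φ).2.contMDiffAt hn
  have h2 : ContMDiffAt 𝓘(ℝ, Coord n) 𝓘(ℝ, Coord n) ∞ (ι' Φ) ((ι Φ).symm x) :=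
    (h'.smooth Φ).1.contMDiffAt ((ι' Φ).open_source.mem_nhds
      (by rw [h'.source_eq]; exact h.symm_mem hΦ))
  refine ContMDiffAt.contMDiffWithinAt ((h2.comp x h1).congr_of_eventuallyEq ?_)
  filter_upwards [hn] with y hy using h.coordMap_eq h' hy

theorem coordMap_coordMap (h : IsPenroseLimit η P ι) (h' : IsPenroseLimit η P' ι')
    {x : P.carrier} (hx : x ∈ ⋃ Φ, (ι Φ).target) : coordMap ι' ι (coordMap ι ι' x) = x := by
  obtain ⟨Φ, hΦ⟩ := mem_iUnion.1 hx
  rw [h.coordMap_eq h' hΦ, h'.coordMap_apply h (h.symm_mem hΦ), (ι Φ).right_inv hΦ]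

theorem coordMap_mem (h : IsPenroseLimit η P ι) (h' : IsPenroseLimit η P' ι')
    {x : P.carrier} (hx : x ∈ ⋃ Φ, (ι Φ).target) : coordMap ι ι' x ∈ ⋃ Φ, (ι' Φ).target := by
  obtain ⟨Φ, hΦ⟩ := mem_iUnion.1 hx
  rw [h.coordMap_eq h' hΦ]
  exact mem_iUnion.2 ⟨Φ, h'.mem_target (h.symm_mem hΦ)⟩

/-- The canonical isometry of two limiting germs. -/
def isometry (h : IsPenroseLimit η P ι) (h' : IsPenroseLimit η P' ι') :
    OpenPartialHomeomorph P.carrier P'.carrier where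
  toFun := coordMap ι ι'
  invFun := coordMap ι' ι
  source := ⋃ Φ, (ι Φ).target
  target := ⋃ Φ, (ι' Φ).target
  map_source' _ hx := h.coordMap_mem h' hx
  map_target' _ hx := h'.coordMap_mem h hx
  left_inv' _ hx := h.coordMap_coordMap h' hx
  right_inv' _ hx := h'.coordMap_coordMap h hx
  open_source := isOpen_iUnion fun Φ => (ι Φ).open_target
  open_target := isOpen_iUnion fun Φ => (ι' Φ).open_target
  continuousOn_toFun := (h.contMDiffOn_coordMap h').continuousOn
  continuousOn_invFun := (h'.contMDiffOn_coordMap h).continuousOn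

theorem pullback_eq (h : IsPenroseLimit η P ι) (h' : IsPenroseLimit η P' ι')
    {Φ : AdaptedChart η} {p : Coord n} (hp : p ∈ slab n Φ.axis) :
    P'.metric.pullback (ι' Φ) p = P.metric.pullback (ι Φ) p :=
  (h'.limit Φ).eqOn (h.limit Φ) hp

theorem tangentMapAt_surjective (h : IsPenroseLimit η P ι) {Φ : AdaptedChart η} {p : Coord n}
    (hp : p ∈ slab n Φ.axis) : Function.Surjective (tangentMapAt (E := Coord n) (ι Φ) p) :=
  LinearMap.injective_iff_surjective (f := (tangentMapAt (E := Coord n) (ι Φ) p).toLinearMap) |>.1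
    ((h.smooth Φ).tangentMapAt_injective (by rwa [h.source_eq]))

/-- Every tangent vector comes from coordinates, and there both metrics are limits of the same
rescaled metrics, hence equal. -/
theorem metric_coordMap (h : IsPenroseLimit η P ι) (h' : IsPenroseLimit η P' ι')
    {Φ : AdaptedChart η} {p : Coord n} (hp : p ∈ slab n Φ.axis) (a b : Coord n) :
    P'.metric.form (coordMap ι ι' (ι Φ p))
        ((mfderiv 𝓘(ℝ, Coord n) 𝓘(ℝ, Coord n) (coordMap ι ι') (ι Φ p) : Coord n →L[ℝ] Coord n) a)
        ((mfderiv 𝓘(ℝ, Coord n) 𝓘(ℝ, Coord n) (coordMap ι ι') (ι Φ p) : Coord n →L[ℝ] Coord n) b) =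
      P.metric.form (ι Φ p) a b := by
  obtain ⟨a, rfl⟩ := h.tangentMapAt_surjective hp a
  obtain ⟨b, rfl⟩ := h.tangentMapAt_surjective hp b
  have hps : p ∈ (ι Φ).source := by rwa [h.source_eq]
  have hF : MDifferentiableAt 𝓘(ℝ, Coord n) 𝓘(ℝ, Coord n) (coordMap ι ι') (ι Φ p) :=
    ((h.contMDiffOn_coordMap h').contMDiffAt ((h.isometry h').open_source.mem_nhds
      (mem_iUnion.2 ⟨Φ, h.mem_target hp⟩))).mdifferentiableAt (by simp)
  have hc := mfderiv_comp p hF ((h.smooth Φ).mdifferentiableAt hps)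
  have he : coordMap ι ι' ∘ ι Φ =ᶠ[𝓝 p] ι' Φ := by
    filter_upwards [(ι Φ).open_source.mem_nhds hps] with q hq
    exact h.coordMap_apply h' (by rwa [← h.source_eq])
  have hT : ∀ c, tangentMapAt (E := Coord n) (ι' Φ) p c =
      (mfderiv 𝓘(ℝ, Coord n) 𝓘(ℝ, Coord n) (coordMap ι ι') (ι Φ p) : Coord n →L[ℝ] Coord n)
        (tangentMapAt (E := Coord n) (ι Φ) p c) := fun c => by
    rw [← tangentMapAt_congr he]
    exact congrArg (fun L : Coord n →L[ℝ] Coord n => L c) hc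
  rw [← hT, ← hT, h.coordMap_apply h' hp]
  exact congrArg (fun L : Coord n →L[ℝ] Coord n →L[ℝ] ℝ => L a b) (h.pullback_eq h' hp)

theorem isCanonicalIsometry (h : IsPenroseLimit η P ι) (h' : IsPenroseLimit η P' ι') :
    IsCanonicalIsometry ι ι' (h.isometry h') where
  source_eq := rfl
  target_eq := rfl
  smooth := h.contMDiffOn_coordMap h'
  smooth_symm := h'.contMDiffOn_coordMap h
  isometry x hx a b := by
    obtain ⟨Φ, hΦ⟩ := mem_iUnion.1 hx
    have key := h.metric_coordMap h' (h.symm_mem hΦ)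
    rw [(ι Φ).right_inv hΦ] at key
    exact key a b
  comp Φ p hp := h.coordMap_apply h' hp
  axis := by
    refine ⟨h.domain_eq.trans h'.domain_eq.symm, fun s hs => ?_⟩
    rw [h.domain_eq] at hs
    obtain ⟨Φ, hΦ⟩ := hs
    have h1 := h.axis Φ _ hΦ
    have h2 := h'.axis Φ _ hΦ
    rw [sub_add_cancel] at h1 h2
    rw [← h1, ← h2]
    exact ⟨mem_iUnion.2 ⟨Φ, h.mem_target hΦ⟩, h.coordMap_apply h' hΦ⟩

/-- The coordinate domains cover the source, and on each of them compatibility with `ι Φ` and `ι' Φ`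
prescribes the value. -/
theorem eqOn_of_isCanonicalIsometry (h : IsPenroseLimit η P ι) (h' : IsPenroseLimit η P' ι')
    {F : OpenPartialHomeomorph P.carrier P'.carrier} (hF : IsCanonicalIsometry ι ι' F) :
    EqOn F (h.isometry h') (h.isometry h').source := by
  intro x hx
  obtain ⟨Φ, hΦ⟩ := mem_iUnion.1 hx
  rw [← (ι Φ).right_inv hΦ, hF.comp Φ _ (h.symm_mem hΦ)]
  exact (h.coordMap_apply h' (h.symm_mem hΦ)).symm

end IsPenroseLimit

end Uniqueness

end

/-! ### The main theorem -/

theorem mainTheorem1 {n : ℕ} {M : Type u} [TopologicalSpace M] [T2Space M]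
    [ChartedSpace (EuclideanSpace ℝ (Fin (n + 2))) M]
    [IsManifold 𝓘(ℝ, EuclideanSpace ℝ (Fin (n + 2))) ∞ M]
    (g : LorentzMetric (EuclideanSpace ℝ (Fin (n + 2))) M)
    (γ : ℝ → M) (I : Set ℝ) (hI : I.OrdConnected) (hI' : I.Nonempty)
    (hγ : IsNullGeodesicOn g γ I) (η : ContactScaleJet g γ I) :
    -- a plane-wave germ that is the limit in all adapted charts exists
    (∃ (P : PlaneWaveGerm.{u} n)
        (ι : AdaptedChart η → OpenPartialHomeomorph (Coord n) P.carrier),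
      IsPenroseLimit η P ι) ∧
    -- and is unique up to a canonical isometry
    (∀ (P P' : PlaneWaveGerm.{u} n)
        (ι : AdaptedChart η → OpenPartialHomeomorph (Coord n) P.carrier)
        (ι' : AdaptedChart η → OpenPartialHomeomorph (Coord n) P'.carrier),
      IsPenroseLimit η P ι → IsPenroseLimit η P' ι' →
      ∃ F : OpenPartialHomeomorph P.carrier P'.carrier, IsCanonicalIsometry ι ι' F ∧
        ∀ F' : OpenPartialHomeomorph P.carrier P'.carrier,
          IsCanonicalIsometry ι ι' F' → EqOn F' F F.source) ∧
    -- convergence to a plane wave means that it is the weighted leading term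
    (∀ (Φ : AdaptedChart η) (q : TensorField n), IsRosen Φ.axis q →
      (Φ.LimitsTo q ↔ Φ.LeadingTerm q)) ∧
    -- transition maps
    (∀ Φ Φ' : AdaptedChart η,
      (∀ s ∈ AdaptedChart.overlap Φ Φ',
        Φ.chart (axisPt n s) ∈ Φ'.chart.target ∧
        AdaptedChart.transition Φ Φ' (axisPt n s) = axisPt n (s + Φ.shift - Φ'.shift)) ∧
      SmoothConv (AdaptedChart.conjTransition Φ Φ') (AdaptedChart.leadingPart Φ Φ')
        (slab n (AdaptedChart.overlap Φ Φ')) ∧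
      ContDiffOn ℝ ∞ (AdaptedChart.leadingPart Φ Φ') (slab n (AdaptedChart.overlap Φ Φ')) ∧
      BijOn (AdaptedChart.leadingPart Φ Φ') (slab n (AdaptedChart.overlap Φ Φ'))
        (slab n (AdaptedChart.overlap Φ' Φ)) ∧
      (∀ c : ℝ, 0 < c → ∀ p ∈ slab n (AdaptedChart.overlap Φ Φ'),
        AdaptedChart.leadingPart Φ Φ' (dil c p) = dil c (AdaptedChart.leadingPart Φ Φ' p)) ∧
      (∀ q q' : TensorField n, Φ.LimitsTo q → Φ'.LimitsTo q' →
        ∀ p ∈ slab n (AdaptedChart.overlap Φ Φ'),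
          pullTensor (AdaptedChart.leadingPart Φ Φ') q' p = q p) ∧
      (AdaptedChart.CompatiblyNormalized Φ Φ' →
        (∀ p ∈ slab n (AdaptedChart.overlap Φ Φ'), AdaptedChart.leadingPart Φ Φ' p = p) ∧
        WeightedOrder (AdaptedChart.overlap Φ Φ') 1
          (fun p => (AdaptedChart.transition Φ Φ' p).1 - p.1) ∧
        WeightedOrder (AdaptedChart.overlap Φ Φ') 2
          (fun p => (AdaptedChart.transition Φ Φ' p).2.1 - p.2.1) ∧
        WeightedOrder (AdaptedChart.overlap Φ Φ') 3
          (fun p => (AdaptedChart.transition Φ Φ' p).2.2 - p.2.2))) := by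
  refine ⟨exists_isPenroseLimit η,
    fun P P' ι ι' h h' => ⟨h.isometry h', h.isCanonicalIsometry h',
      fun F' hF' => h.eqOn_of_isCanonicalIsometry h' hF'⟩,
    fun Φ q hq => Φ.limitsTo_iff_leadingTerm hq, fun Φ Φ' => ?_⟩
  exact ⟨fun s hs => ⟨AdaptedChart.chart_axisPt_mem hs, AdaptedChart.transition_axisPt hs⟩,
    AdaptedChart.smoothConv_conjTransition Φ Φ', AdaptedChart.contDiffOn_leadingPart Φ Φ',
    AdaptedChart.bijOn_leadingPart Φ Φ', fun c hc p hp => AdaptedChart.leadingPart_dil hc hp,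
    fun q q' hq hq' p hp => AdaptedChart.pullTensor_leadingPart hq hq' hp,
    fun h => ⟨fun p hp => h.leadingPart_eq hp,
      -- The projections to `u`, `x`, `v` are homogeneous of degrees `0`, `1`, `2` under `δ_ε`,
      -- which gives the orders `1`, `2`, `3`.
      h.weightedOrder (r := 0) (ContinuousLinearMap.fst ℝ ℝ _) (fun ε p => by simp [dil]),
      h.weightedOrder (r := 1) (xProj n) (fun ε p => by simp [dil]),
      h.weightedOrder (r := 2) (vProj n) (fun ε p => by simp [dil])⟩⟩
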